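/- **Setting.** For $\varphi$ Schwartz, $\widehat\varphi(\omega)=\int_{\mathbb R}\varphi(t)e^{-it\omega}\,dt$, and for a tempered distribution $g$ its Fourier transform $\mathcal F[g]$ is given by $\langle \mathcal F[g],\varphi\rangle=\langle g,\widehat\varphi\rangle$. Write $\widetilde f(x)=f(-x)$. *Kernel.* Let $K:\mathbb R\to\mathbb R$ satisfy: $K$ is symmetric, and $K(t)>0$ for $t\ne0$; $K(t)\to0$ as $t\to\infty$ and $K$ is eventually decreasing; $K\in L^1_{\rm loc}(\mathbb R)$; for every $\omega\neq0$ the improper integral $\int_0^\infty K(t)\cos(\omega t)\,dt$ is positive; and either $K\in L^1(\mathbb R)$, or $K\notin L^1(\mathbb R)$ and there is $\alpha\in(0,1)$ such that $t^{\alpha}K(t)$ has a limit in $(0,\infty)$ as $t\to\infty$. Put $K^+(t)=K(t)1_{\{t\ge0\}}$. *The operator $V$.* Let $\nu$ be a non-negative Borel measure on $\mathbb R$, absolutely continuous with respect to Lebesgue measure, with $\int(1+x^2)^{-k}\,\nu(dx)<\infty$ for some integer $k$. Let $\xi$ be a centered Gaussian random measure with respect to $\nu$: a map $E\mapsto\xi(E)\in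 L^2(\Omega;\mathbb C)$ on the Borel sets of finite $\nu$-measure, whose values are jointly Gaussian with mean zero (as $\mathbb R^2$-valued variables), with $\mathbb E[\xi(E_1)\overline{\xi(E_2)}]=\nu(E_1\cap E_2)$. The stochastic integral $g\mapsto\int g\,d\xi$ is the resulting isometry $L^2(\nu)\to L^2(\Omega;\mathbb C)$ with $\int 1_E\,d\xi=\xi(E)$. Let ${\rm Dom}(V)$ be the set of tempered distributions $g$ such that $\mathcal F[g]$ is a function that belongs to $L^2(\nu)$, and put $\langle V,g\rangle=\int\overline{\mathcal F[g](\omega)}\,\xi(d\omega)$ for $g\in{\rm Dom}(V)$. *Weak solutions.* Let $m,\beta>0$ and $\lambda=0$. Let $\dot W$ and $F$ be random distributions with $\mathbb E[\langle\dot W,\varphi_1\rangle\overline{\langle\dot W,\varphi_2\rangle}]=\int\varphi_1\varphi_2\,dt$ and $\mathbb E[\langle F,\varphi_1\rangle\overline{\langle F,\varphi_2\rangle}]=\int K(t)(\varphi_1*\widetilde{\varphi_2})(t)\,dt$ for real Schwartz functions $\varphi_1,\varphi_2$. Then $V$ is a weak solution of the generalized Langevin equation $$\langle V,-m\varphi'+\lambda\varphi+\beta\,\widetilde{K^+*\widetilde\varphi}\,\rangle=\sqrt{2\lambda}\,\langle\dot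 W,\varphi\rangle+\sqrt\beta\,\langle F,\varphi\rangle$$ if $K^+*\varphi\in{\rm Dom}(V)$ for all real Schwartz $\varphi$ and if, for all real Schwartz $\varphi,\psi$, the left-hand sides for $\varphi$ and $\psi$ have the same covariance $\mathbb E[\,\cdot\;\overline{\,\cdot\,}\,]$ as the right-hand sides for $\varphi$ and $\psi$. **Theorem.** Let $m,\beta>0$, $\lambda=0$, let $K$ be as above, and let $V$ be a weak solution of the generalized Langevin equation. Assume further that $K$ is positive definite, i.e. $K$ is continuous and $\sum_{j,k}K(t_j-t_k)z_j\overline{z_k}\ge0$ for all finite families of times $t_j\in\mathbb R$ and $z_j\in\mathbb C$, and that for some $b>3$ $$K(0)-K(t)=O\big(|\log t|^{-b}\big),\qquad t\to0^+.$$ Then the Gaussian process $V(t)=\langle V,\delta_t\rangle$ is well defined (i.e. $\delta_t\in{\rm Dom}(V)$ for all $t\in\mathbb R$) and it is a.s. continuously differentiable: there is a process $\eta$ with $\eta(t)=V(t)$ a.s. for every $t\in\mathbb R$ such that almost surely $t\mapsto\eta(t)$ is continuously differentiable on $\mathbb R$. -/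

import Mathlib

open MeasureTheory ProbabilityTheory Filter Topology
open scoped ComplexConjugate SchwartzMap ENNReal ComplexOrder

noncomputable section

namespace GLE

/-! ### Tempered distributions and their Fourier transform -/

/-- The dilation `x ↦ x / (2π)` of the real line. -/
def scale : ℝ ≃L[ℝ] ℝ :=
  ContinuousLinearEquiv.unitsEquivAut ℝ (Units.mk0 (2 * Real.pi)⁻¹ (by positivity))

/-- The Fourier transform `φ ↦ φ̂`, `φ̂(ω) = ∫ φ(t) exp(-i t ω) dt`, on Schwartz functions. -/
def fourierS : 𝓢(ℝ, ℂ) →L[ℂ] 𝓢(ℝ, ℂ) :=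
  (SchwartzMap.compCLMOfContinuousLinearEquiv ℂ scale).comp
    (FourierTransform.fourierCLM ℂ 𝓢(ℝ, ℂ))

theorem fourierS_apply (φ : 𝓢(ℝ, ℂ)) (w : ℝ) :
    fourierS φ w = ∫ t : ℝ, φ t * Complex.exp (-(Complex.I * t * w)) := by
  have h : fourierS φ w = FourierTransform.fourier (φ : ℝ → ℂ) (w * (2 * Real.pi)⁻¹) := by
    simp [fourierS, scale, SchwartzMap.fourier_coe]
  rw [h, Real.fourier_real_eq_integral_exp_smul]
  refine integral_congr_ae (Eventually.of_forall fun t => ?_)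
  simp only [smul_eq_mul]
  rw [mul_comm]
  congr 2
  have hpi : (Real.pi : ℂ) ≠ 0 := by exact_mod_cast Real.pi_ne_zero
  push_cast
  field_simp

/-- The Fourier transform of a tempered distribution: `⟨F[g], φ⟩ = ⟨g, φ̂⟩`. -/
def fourierT (g : 𝓢'(ℝ, ℂ)) : 𝓢'(ℝ, ℂ) :=
  PointwiseConvergenceCLM.precomp ℂ fourierS g

theorem fourierT_apply (g : 𝓢'(ℝ, ℂ)) (φ : 𝓢(ℝ, ℂ)) : fourierT g φ = g (fourierS φ) := rfl

/-- The tempered distribution `T` is (integration against) the function `f`. -/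
def IsFun (T : 𝓢'(ℝ, ℂ)) (f : ℝ → ℂ) : Prop :=
  ∀ φ : 𝓢(ℝ, ℂ), Integrable (fun t => f t * φ t) ∧ T φ = ∫ t, f t * φ t

open Classical in
/-- The tempered distribution given by the function `f`, with value `0` if there is none. -/
def ofFun (f : ℝ → ℂ) : 𝓢'(ℝ, ℂ) :=
  if h : ∃ T, IsFun T f then h.choose else 0

/-! ### Random measures and the stochastic integral -/

/-- The Borel sets of finite `ν`-measure. -/
abbrev FinSet (ν : Measure ℝ) : Type := {E : Set ℝ // MeasurableSet E ∧ ν E ≠ ∞}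

variable {Ω : Type*} [MeasurableSpace Ω]

/-- A random measure with respect to `ν`: a map `ξ` from the Borel sets of finite `ν`-measure to
`L²(Ω)` with `E[ξ(E₁) conj ξ(E₂)] = ν(E₁ ∩ E₂)`. -/
structure RandomMeasure (ν : Measure ℝ) (P : Measure Ω) where
  /-- the values of the random measure -/
  toFun : FinSet ν → Lp ℂ 2 P
  covariance : ∀ E₁ E₂ : FinSet ν,
    ∫ x, toFun E₁ x * conj (toFun E₂ x) ∂P = (ν.real (E₁.1 ∩ E₂.1) : ℂ)

variable {ν : Measure ℝ} {P : Measure Ω}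

/-- The random measure is centered and Gaussian: its values are jointly Gaussian, with mean `0`. -/
structure RandomMeasure.IsGaussian (ξ : RandomMeasure ν P) : Prop where
  gaussian : IsGaussianProcess (fun (E : FinSet ν) (x : Ω) => ξ.toFun E x) P
  centered : ∀ E : FinSet ν, ∫ x, ξ.toFun E x ∂P = 0

/-- The indicator function of `E` as an element of `L²(ν)`. -/
def indicatorL2 (E : FinSet ν) : Lp ℂ 2 ν := indicatorConstLp 2 E.2.1 E.2.2 (1 : ℂ)

/-- The step function `∑ c_E 1_E` given by the finitely many coefficients `c_E`. -/
def stepL2 (ν : Measure ℝ) : (FinSet ν →₀ ℂ) →ₗ[ℂ] Lp ℂ 2 ν :=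
  Finsupp.linearCombination ℂ indicatorL2

/-- The stochastic integral `∑ c_E ξ(E)` of a step function `∑ c_E 1_E`. -/
def RandomMeasure.stepIntegral (ξ : RandomMeasure ν P) : (FinSet ν →₀ ℂ) →ₗ[ℂ] Lp ℂ 2 P :=
  Finsupp.linearCombination ℂ ξ.toFun

/-- The stochastic integral `g ↦ ∫ g dξ`, the continuous extension to `L²(ν)` of the integral of
step functions. -/
def RandomMeasure.integral (ξ : RandomMeasure ν P) : Lp ℂ 2 ν →L[ℂ] Lp ℂ 2 P :=
  ξ.stepIntegral.extendOfNorm (stepL2 ν)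

theorem denseRange_stepL2 (ν : Measure ℝ) : DenseRange (stepL2 ν) := by
  have key : ∀ f : Lp ℂ 2 ν, f ∈ (LinearMap.range (stepL2 ν)).topologicalClosure := by
    intro f
    refine Lp.induction (by norm_num) (motive := fun f : Lp ℂ 2 ν =>
      f ∈ (LinearMap.range (stepL2 ν)).topologicalClosure) ?_ ?_ ?_ f
    · intro c s hs hμs
      refine Submodule.le_topologicalClosure _ ⟨Finsupp.single ⟨s, hs, hμs.ne⟩ c, ?_⟩
      rw [Lp.simpleFunc.coe_indicatorConst]
      simp only [stepL2, Finsupp.linearCombination_single, indicatorL2]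
      apply Lp.ext
      filter_upwards [Lp.coeFn_smul c (indicatorConstLp 2 hs hμs.ne (1 : ℂ)),
        indicatorConstLp_coeFn (p := 2) (hs := hs) (hμs := hμs.ne) (c := (1 : ℂ)),
        indicatorConstLp_coeFn (p := 2) (hs := hs) (hμs := hμs.ne) (c := c)] with x h1 h2 h3
      rw [h1, Pi.smul_apply, h2, h3]
      by_cases hx : x ∈ s <;> simp [hx]
    · intro f g hf hg _ h1 h2
      exact Submodule.add_mem _ h1 h2
    · exact Submodule.isClosed_topologicalClosure _
  intro f
  have := key f
  rwa [← SetLike.mem_coe, Submodule.topologicalClosure_coe, LinearMap.coe_range] at this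

theorem RandomMeasure.inner_toFun (ξ : RandomMeasure ν P) (E₁ E₂ : FinSet ν) :
    inner ℂ (ξ.toFun E₁) (ξ.toFun E₂) = inner ℂ (indicatorL2 E₁) (indicatorL2 E₂) := by
  rw [indicatorL2, indicatorL2,
    L2.inner_indicatorConstLp_one_indicatorConstLp_one E₁.2.1 E₂.2.1 E₁.2.2 E₂.2.2,
    L2.inner_def, Set.inter_comm]
  exact ξ.covariance E₂ E₁

theorem RandomMeasure.norm_stepIntegral (ξ : RandomMeasure ν P) (c : FinSet ν →₀ ℂ) :
    ‖ξ.stepIntegral c‖ = ‖stepL2 ν c‖ := by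
  have h : inner ℂ (ξ.stepIntegral c) (ξ.stepIntegral c)
      = inner ℂ (stepL2 ν c) (stepL2 ν c) := by
    simp only [RandomMeasure.stepIntegral, stepL2, Finsupp.linearCombination_apply,
      Finsupp.sum, sum_inner, inner_sum, inner_smul_left, inner_smul_right, ξ.inner_toFun]
  rw [@norm_eq_sqrt_re_inner ℂ, @norm_eq_sqrt_re_inner ℂ _ _ _ _ (stepL2 ν c), h]

theorem RandomMeasure.integral_stepL2 (ξ : RandomMeasure ν P) (c : FinSet ν →₀ ℂ) :
    ξ.integral (stepL2 ν c) = ξ.stepIntegral c :=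
  LinearMap.extendOfNorm_eq (denseRange_stepL2 ν)
    ⟨1, fun c => by rw [ξ.norm_stepIntegral, one_mul]⟩ c

/-- `∫ 1_E dξ = ξ(E)`. -/
theorem RandomMeasure.integral_indicator (ξ : RandomMeasure ν P) (E : FinSet ν) :
    ξ.integral (indicatorL2 E) = ξ.toFun E := by
  simpa [stepL2, RandomMeasure.stepIntegral] using ξ.integral_stepL2 (Finsupp.single E 1)

/-- The stochastic integral is an isometry from `L²(ν)` to `L²(Ω)`. -/
theorem RandomMeasure.norm_integral (ξ : RandomMeasure ν P) (g : Lp ℂ 2 ν) :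
    ‖ξ.integral g‖ = ‖g‖ := by
  refine (denseRange_stepL2 ν).induction_on g
    (isClosed_eq (ξ.integral.continuous.norm) continuous_norm) fun c => ?_
  rw [ξ.integral_stepL2, ξ.norm_stepIntegral]

/-! ### The operator of a stationary random distribution, extended to tempered distributions -/

/-- The growth condition `∫ ν(dx) / (1 + x²)^k < ∞`, for some `k`, on a spectral measure. -/
def IsSpectralMeasure (ν : Measure ℝ) : Prop :=
  ∃ k : ℕ, Integrable (fun x : ℝ => ((1 + x ^ 2) ^ k)⁻¹) ν

/-- The domain of the extended operator: the tempered distributions whose Fourier transform is a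
function that belongs to `L²(ν)`. -/
def Dom (ν : Measure ℝ) : Set 𝓢'(ℝ, ℂ) :=
  {g | ∃ G : ℝ → ℂ, IsFun (fourierT g) G ∧ MemLp G 2 ν}

open Classical in
/-- The extended operator `⟨Φ, g⟩ = ∫ conj (F[g](ω)) ξ(dω)` for `g` in the domain (and `0`
otherwise). If `ν` is absolutely continuous with respect to Lebesgue measure, then this does not
depend on the chosen function `G` that represents `F[g]`. -/
def RandomMeasure.op (ξ : RandomMeasure ν P) (g : 𝓢'(ℝ, ℂ)) : Lp ℂ 2 P :=
  if h : g ∈ Dom ν then ξ.integral (h.choose_spec.2.star.toLp (star h.choose)) else 0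

/-- The function-valued version `V(t) = ⟨Φ, δ_t⟩`. -/
def RandomMeasure.process (ξ : RandomMeasure ν P) (t : ℝ) : Lp ℂ 2 P :=
  ξ.op (TemperedDistribution.delta t)

/-! ### The generalized Langevin equation -/

/-- The reflection `f̃(x) = f(-x)`. -/
def refl (f : ℝ → ℝ) : ℝ → ℝ := fun x => f (-x)

/-- The convolution `(f * g)(x) = ∫ f(s) g(x - s) ds`. -/
def conv (f g : ℝ → ℝ) : ℝ → ℝ := convolution f g (ContinuousLinearMap.mul ℝ ℝ) volume

/-- `K⁺(t) = K(t) 1_{t ≥ 0}`. -/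
def plus (K : ℝ → ℝ) : ℝ → ℝ := (Set.Ici (0 : ℝ)).indicator K

/-- The function `-m φ' + λ φ + β (K⁺ * φ̃)~` against which the velocity is tested. -/
def testFun (m lam β : ℝ) (K : ℝ → ℝ) (φ : 𝓢(ℝ, ℝ)) : ℝ → ℝ := fun t =>
  -m * deriv φ t + lam * φ t + β * refl (conv (plus K) (refl φ)) t

variable {Ω' : Type*} [MeasurableSpace Ω'] {P' : Measure Ω'}

/-- White noise: `E[⟨W, φ₁⟩ conj ⟨W, φ₂⟩] = ∫ φ₁ φ₂`. -/
def IsWhiteNoise (W : 𝓢(ℝ, ℝ) →ₗ[ℝ] Lp ℂ 2 P') : Prop :=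
  ∀ φ₁ φ₂ : 𝓢(ℝ, ℝ), ∫ x, W φ₁ x * conj (W φ₂ x) ∂P' = ((∫ t, φ₁ t * φ₂ t : ℝ) : ℂ)

/-- `F` is a stationary random distribution with covariance `K`:
`E[⟨F, φ₁⟩ conj ⟨F, φ₂⟩] = ∫ K (φ₁ * φ̃₂)`. -/
def HasCovariance (K : ℝ → ℝ) (F : 𝓢(ℝ, ℝ) →ₗ[ℝ] Lp ℂ 2 P') : Prop :=
  ∀ φ₁ φ₂ : 𝓢(ℝ, ℝ),
    ∫ x, F φ₁ x * conj (F φ₂ x) ∂P' = ((∫ t, K t * conv φ₁ (refl φ₂) t : ℝ) : ℂ)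

/-- The operator of `ξ` is a weak solution of the generalized Langevin equation
`⟨V, -m φ' + λ φ + β (K⁺ * φ̃)~⟩ = √(2λ) ⟨W, φ⟩ + √β ⟨F, φ⟩`: every `K⁺ * φ` belongs to its domain,
and both sides of the equation have the same covariances. -/
structure IsWeakSolution (m lam β : ℝ) (K : ℝ → ℝ) (W F : 𝓢(ℝ, ℝ) →ₗ[ℝ] Lp ℂ 2 P')
    (ξ : RandomMeasure ν P) : Prop where
  mem_dom : ∀ φ : 𝓢(ℝ, ℝ), ∃ T ∈ Dom ν, IsFun T fun t => (conv (plus K) φ t : ℂ)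
  covariance_eq : ∀ φ ψ : 𝓢(ℝ, ℝ),
    ∫ x, ξ.op (ofFun fun t => (testFun m lam β K φ t : ℂ)) x
        * conj (ξ.op (ofFun fun t => (testFun m lam β K ψ t : ℂ)) x) ∂P
      = ∫ x, (Real.sqrt (2 * lam) • W φ + Real.sqrt β • F φ) x
        * conj ((Real.sqrt (2 * lam) • W ψ + Real.sqrt β • F ψ) x) ∂P'

/-! ### Memory kernels -/

/-- The standing assumptions on the memory kernel, for a kernel that is finite at the origin. -/
structure IsAdmissible (K : ℝ → ℝ) : Prop where
  symm : ∀ t, K (-t) = K t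
  pos : ∀ t, t ≠ 0 → 0 < K t
  tendsto_zero : Tendsto K atTop (𝓝 0)
  eventually_decreasing : ∃ A, AntitoneOn K (Set.Ici A)
  locallyIntegrable : LocallyIntegrable K
  cos_pos : ∀ w : ℝ, w ≠ 0 → ∃ L : ℝ, 0 < L ∧
    Tendsto (fun T : ℝ => ∫ t in (0 : ℝ)..T, K t * Real.cos (w * t)) atTop (𝓝 L)
  integrable_or_power_law : Integrable K ∨
    (¬ Integrable K ∧ ∃ α ∈ Set.Ioo (0 : ℝ) 1, ∃ C : ℝ, 0 < C ∧
      Tendsto (fun t : ℝ => K t / t ^ (-α)) atTop (𝓝 C))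

/-- A positive definite function: continuous, with `∑ r(t_j - t_k) z_j conj z_k ≥ 0` for all finite
families of times and complex numbers. -/
def IsPositiveDefinite (r : ℝ → ℂ) : Prop :=
  Continuous r ∧ ∀ (n : ℕ) (t : Fin n → ℝ) (z : Fin n → ℂ),
    0 ≤ ∑ j, ∑ k, r (t j - t k) * z j * conj (z k)

end GLE

end

/-!
Write `φ̂` for the Fourier transform of `φ`. The Fourier transform of the test function
`-m φ' + β (K⁺ * φ̃)~` is `φ̂` times the factor `-i m ω + β conj (k ω)`, where `k` is the improper
Fourier integral of `K⁺`. Since `K` is eventually decreasing, `k` is bounded on `|ω| ≥ 1`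
(`exists_oscillatory_limit`), so for large `|ω|` the factor has modulus at least `m |ω| / 2`. The
stochastic integral is an isometry, so equality of the covariances in the Langevin equation gives
the energy inequality (`IsWeakSolution.exists_energy_le`)

  `∫_{|ω| > R} (m ω / 2)² |φ̂(ω)|² dν ≤ β ∫ K (φ * φ̃)`.

Only high frequencies matter here: `ν` is finite on bounded sets by the growth condition, and so
the behaviour of `k` near the origin plays no role.

Letting `φ` approximate `δ_0` and `δ_0 - δ_t`, Fatou's lemma turns this into `∫ ω² dν < ∞` and
`∫ ω² |1 - exp(-i t ω)|² dν ≤ C (K 0 - K t + t²)` (`exists_spectral_bounds`). Hence `V(t)` is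
the stochastic integral of `exp(i t ω)`, and the stochastic integral `Y(t)` of `i ω exp(i t ω)`
is its derivative in mean square, with `‖Y(t) - Y(s)‖² = O(|log |t - s||^(-b))`.

Stochastic integrals have Gaussian tails (`RandomMeasure.IsGaussian.measure_le_norm_integral`).
Over dyadic intervals of length `2⁻ⁿ` the increments of `Y` have variance `O(n⁻ᵇ)`, and since
`b > 3` the Borel-Cantelli lemma bounds, almost surely and for all large `n`, all the
increments of level `n` in a bounded interval by `n⁻ᵃ` with some `a > 1`. These bounds are
summable, so `Y` has a continuous version `Z`
(`RandomMeasure.IsGaussian.exists_continuous_version`). Riemann sums identify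
`V(0) + ∫_0^t Z(s) ds` as a version of `V(t)` (`RandomMeasure.exists_contDiff_version`), and its
paths are continuously differentiable.
-/

noncomputable section

namespace GLE

variable {Ω : Type*} [MeasurableSpace Ω] {ν : Measure ℝ} {P : Measure Ω}
  {Ω' : Type*} [MeasurableSpace Ω'] {P' : Measure Ω'}

/-! ### Oscillatory integrals of eventually decreasing kernels -/

theorem norm_exp_neg_I_mul (s w : ℝ) : ‖Complex.exp (-(Complex.I * s * w))‖ = 1 := by
  have : -(Complex.I * s * w) = ((-(s * w) : ℝ) : ℂ) * Complex.I := by push_cast; ring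
  rw [this, Complex.norm_exp_ofReal_mul_I]

theorem norm_intervalIntegral_mul_exp_le {K : ℝ → ℝ} {M S T w : ℝ} (hST : S ≤ T)
    (h0 : ∀ t, 0 ≤ K t) (hM : ∀ t, S ≤ t → K t ≤ M) :
    ‖∫ s in S..T, (K s : ℂ) * Complex.exp (-(Complex.I * s * w))‖ ≤ M * (T - S) := by
  have h := intervalIntegral.norm_integral_le_of_norm_le_const (a := S) (b := T) (C := M)
    (f := fun s : ℝ => (K s : ℂ) * Complex.exp (-(Complex.I * s * w))) (by
      intro s hs
      rw [Set.uIoc_of_le hST] at hs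
      rw [norm_mul, norm_exp_neg_I_mul, mul_one, Complex.norm_real, Real.norm_of_nonneg (h0 s)]
      exact hM s hs.1.le)
  rwa [abs_of_nonneg (by linarith)] at h

/-- The half-period shift `s ↦ s + π / |w|` changes the sign of the exponential, which turns the
oscillatory integral into a telescoping integral of increments of `K`. -/
theorem norm_intervalIntegral_antitoneOn_mul_exp_le {K : ℝ → ℝ} {A S T w : ℝ}
    (hK : AntitoneOn K (Set.Ici A)) (hc : Continuous K) (h0 : ∀ t, 0 ≤ K t)
    (hAS : A ≤ S) (hST : S ≤ T) (hw : 1 ≤ |w|) :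
    ‖∫ s in S..T, (K s : ℂ) * Complex.exp (-(Complex.I * s * w))‖ ≤ 2 * Real.pi * K S := by
  set p : ℝ := Real.pi / |w| with hp
  have hw0 : 0 < |w| := by linarith
  have hp0 : 0 < p := by positivity
  have hpπ : p ≤ Real.pi := div_le_self Real.pi_pos.le hw
  set e : ℝ → ℂ := fun s => Complex.exp (-(Complex.I * s * w)) with he
  have hec : Continuous e := by fun_prop
  have hshift : ∀ s, e (s - p) = -e s := by
    intro s
    have h1 : -(Complex.I * ((s - p : ℝ) : ℂ) * w) = -(Complex.I * s * w) +
      ((p * w : ℝ) : ℂ) * Complex.I := by push_cast; ring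
    have h2 : Complex.exp (((p * w : ℝ) : ℂ) * Complex.I) = -1 := by
      rcases abs_choice w with h | h
      · have : p * w = Real.pi := by rw [hp, h]; rw [h] at hw0; field_simp
        rw [this, Complex.exp_pi_mul_I]
      · have : p * w = -Real.pi := by
          rw [hp, h]; rw [h] at hw0
          have : w ≠ 0 := by intro h; simp [h] at hw0
          field_simp
        rw [this]; push_cast
        rw [neg_mul, Complex.exp_neg, Complex.exp_pi_mul_I]; norm_num
    simp only [he]
    rw [h1, Complex.exp_add, h2]; ring
  have hne : ∀ s, ‖e s‖ = 1 := fun s => norm_exp_neg_I_mul s w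
  have hKS : ∀ t, S ≤ t → K t ≤ K S := fun t ht => hK (Set.mem_Ici.2 hAS)
    (Set.mem_Ici.2 (hAS.trans ht)) ht
  have hKS0 := h0 S
  -- on less than a half-period the trivial bound suffices
  by_cases hT : T < S + p
  · refine (norm_intervalIntegral_mul_exp_le hST h0 hKS).trans ?_
    nlinarith
  push Not at hT
  have hcK : Continuous fun s => (K s : ℂ) * e s := by fun_prop
  have hcK' : Continuous fun s => (K (s - p) : ℂ) * e s := by fun_prop
  have h1 : ∫ s in S..T, (K s : ℂ) * e s = -∫ s in (S + p)..(T + p), (K (s - p) : ℂ) * e s := by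
    rw [← intervalIntegral.integral_neg]
    have := intervalIntegral.integral_comp_sub_right (a := S + p) (b := T + p)
      (fun s => (K s : ℂ) * e s) p
    rw [add_sub_cancel_right, add_sub_cancel_right] at this
    rw [← this]
    refine intervalIntegral.integral_congr fun s _ => ?_
    rw [hshift]; ring
  have h2 : ∫ s in S..T, (K s : ℂ) * e s = (∫ s in S..(S + p), (K s : ℂ) * e s) +
      ∫ s in (S + p)..T, (K s : ℂ) * e s :=
    (intervalIntegral.integral_add_adjacent_intervals (hcK.intervalIntegrable _ _)
      (hcK.intervalIntegrable _ _)).symm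
  have h3 : ∫ s in (S + p)..(T + p), (K (s - p) : ℂ) * e s =
      (∫ s in (S + p)..T, (K (s - p) : ℂ) * e s) + ∫ s in T..(T + p), (K (s - p) : ℂ) * e s :=
    (intervalIntegral.integral_add_adjacent_intervals (hcK'.intervalIntegrable _ _)
      (hcK'.intervalIntegrable _ _)).symm
  have h4 : (∫ s in (S + p)..T, (K s : ℂ) * e s) - ∫ s in (S + p)..T, (K (s - p) : ℂ) * e s =
      ∫ s in (S + p)..T, ((K s : ℂ) * e s - (K (s - p) : ℂ) * e s) :=
    (intervalIntegral.integral_sub (hcK.intervalIntegrable _ _)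
      (hcK'.intervalIntegrable _ _)).symm
  have hci : ∀ a b, IntervalIntegrable K volume a b := fun a b => hc.intervalIntegrable _ _
  have b1 : ‖∫ s in S..(S + p), (K s : ℂ) * e s‖ ≤ K S * p := by
    have := norm_intervalIntegral_mul_exp_le (K := K) (M := K S) (S := S) (T := S + p) (w := w)
      (by linarith) h0 hKS
    rwa [add_sub_cancel_left] at this
  have b2 : ‖∫ s in T..(T + p), (K (s - p) : ℂ) * e s‖ ≤ K S * p := by
    have := norm_intervalIntegral_mul_exp_le (K := fun s => K (s - p)) (M := K S) (S := T)
      (T := T + p) (w := w) (by linarith) (fun t => h0 _) (fun t ht => hKS _ (by linarith))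
    rwa [add_sub_cancel_left] at this
  have b3 : ‖∫ s in (S + p)..T, ((K s : ℂ) * e s - (K (s - p) : ℂ) * e s)‖ ≤ K S * p := by
    have hb : ‖∫ s in (S + p)..T, ((K s : ℂ) * e s - (K (s - p) : ℂ) * e s)‖ ≤
        ∫ s in (S + p)..T, (K (s - p) - K s) := by
      refine intervalIntegral.norm_integral_le_of_norm_le hT ?_
        (Continuous.intervalIntegrable (by fun_prop) _ _)
      refine Eventually.of_forall fun s hs => ?_
      rw [← sub_mul, norm_mul, hne, mul_one, ← Complex.ofReal_sub, Complex.norm_real,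
        Real.norm_eq_abs, abs_sub_comm, abs_of_nonneg]
      have := hK (a := s - p) (b := s) (Set.mem_Ici.2 (by linarith [hs.1]))
        (Set.mem_Ici.2 (by linarith [hs.1])) (by linarith)
      linarith
    refine hb.trans ?_
    have hcp : Continuous fun s => K (s - p) := by fun_prop
    rw [intervalIntegral.integral_sub (hcp.intervalIntegrable _ _) (hci _ _),
      intervalIntegral.integral_comp_sub_right (fun s => K s) p, add_sub_cancel_right]
    have e1 := intervalIntegral.integral_add_adjacent_intervals (hci S (S + p)) (hci (S + p) T)
    have e2 := intervalIntegral.integral_add_adjacent_intervals (hci S (T - p)) (hci (T - p) T)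
    have e3 : 0 ≤ ∫ s in (T - p)..T, K s :=
      intervalIntegral.integral_nonneg (by linarith) fun s _ => h0 s
    have e4 : ∫ s in S..(S + p), K s ≤ ∫ s in S..(S + p), K S :=
      intervalIntegral.integral_mono_on (by linarith) (hci _ _) (by simp)
        fun s hs => hKS s hs.1
    rw [intervalIntegral.integral_const, add_sub_cancel_left, smul_eq_mul] at e4
    linarith
  -- twice the integral: two boundary terms and an integral of increments of `K` over `p`
  have h5 : (2 : ℂ) * ∫ s in S..T, (K s : ℂ) * e s = (∫ s in S..(S + p), (K s : ℂ) * e s) +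
      (∫ s in (S + p)..T, ((K s : ℂ) * e s - (K (s - p) : ℂ) * e s)) -
      ∫ s in T..(T + p), (K (s - p) : ℂ) * e s := by
    rw [← h4]
    linear_combination h1 + h2 - h3
  have h6 : 2 * ‖∫ s in S..T, (K s : ℂ) * e s‖ ≤ K S * p + K S * p + K S * p := by
    have : ‖(2 : ℂ) * ∫ s in S..T, (K s : ℂ) * e s‖ = 2 * ‖∫ s in S..T, (K s : ℂ) * e s‖ := by
      rw [norm_mul]; norm_num
    rw [← this, h5]
    exact (norm_sub_le _ _).trans (add_le_add ((norm_add_le _ _).trans (add_le_add b1 b3)) b2)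
  nlinarith

/-- The improper Fourier integral of `K⁺` converges, boundedly, away from the origin. -/
theorem exists_oscillatory_limit {K : ℝ → ℝ} {A M : ℝ} (hK : AntitoneOn K (Set.Ici A))
    (hc : Continuous K) (h0 : ∀ t, 0 ≤ K t) (hM : ∀ t, K t ≤ M) (hlim : Tendsto K atTop (𝓝 0)) :
    ∃ (C : ℝ) (k : ℝ → ℂ), 0 ≤ C ∧ Measurable k ∧ (∀ w, ‖k w‖ ≤ C) ∧
      (∀ T w : ℝ, 0 ≤ T → 1 ≤ |w| →
        ‖∫ s in (0 : ℝ)..T, (K s : ℂ) * Complex.exp (-(Complex.I * s * w))‖ ≤ C) ∧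
      ∀ w : ℝ, 1 ≤ |w| → Tendsto (fun T : ℝ => ∫ s in (0 : ℝ)..T, (K s : ℂ) *
        Complex.exp (-(Complex.I * s * w))) atTop (𝓝 (k w)) := by
  have hcc : ∀ w : ℝ, Continuous fun s : ℝ => (K s : ℂ) * Complex.exp (-(Complex.I * s * w)) :=
    fun w => by fun_prop
  have hM0 : 0 ≤ M := (h0 0).trans (hM 0)
  set B := max A 0
  have hB : 0 ≤ B := le_max_right _ _
  have hadd : ∀ w a b c : ℝ, (∫ s in a..b, (K s : ℂ) * Complex.exp (-(Complex.I * s * w))) +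
      ∫ s in b..c, (K s : ℂ) * Complex.exp (-(Complex.I * s * w)) =
      ∫ s in a..c, (K s : ℂ) * Complex.exp (-(Complex.I * s * w)) := fun w a b c =>
    intervalIntegral.integral_add_adjacent_intervals ((hcc w).intervalIntegrable _ _)
      ((hcc w).intervalIntegrable _ _)
  set C := M * B + 2 * Real.pi * M with hC
  have hbd : ∀ T w : ℝ, 0 ≤ T → 1 ≤ |w| →
      ‖∫ s in (0 : ℝ)..T, (K s : ℂ) * Complex.exp (-(Complex.I * s * w))‖ ≤ C := by
    intro T w hT hw
    have hπM : 0 ≤ 2 * Real.pi * M := by positivity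
    rcases le_total T B with h | h
    · refine (norm_intervalIntegral_mul_exp_le hT h0 fun t _ => hM t).trans ?_
      nlinarith
    · rw [← hadd w 0 B T]
      refine (norm_add_le _ _).trans (add_le_add ?_ ?_)
      · simpa using norm_intervalIntegral_mul_exp_le (w := w) hB h0 fun t _ => hM t
      · refine (norm_intervalIntegral_antitoneOn_mul_exp_le hK hc h0 (le_max_left _ _) h hw).trans ?_
        gcongr
        exact hM _
  have hex : ∀ w : ℝ, 1 ≤ |w| → ∃ l : ℂ, Tendsto (fun T : ℝ => ∫ s in (0 : ℝ)..T, (K s : ℂ) *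
        Complex.exp (-(Complex.I * s * w))) atTop (𝓝 l) := by
    intro w hw
    refine cauchySeq_tendsto_of_complete ?_
    -- below `A` the modulus is any finite bound; only its decay at infinity matters
    refine cauchySeq_of_le_tendsto_0' (fun T => if A ≤ T then 2 * Real.pi * K T else
      ‖∫ s in (0 : ℝ)..T, (K s : ℂ) * Complex.exp (-(Complex.I * s * w))‖ + C +
      M * |T|) ?_ ?_
    · intro S T hST
      rw [dist_comm, dist_eq_norm, ← hadd w 0 S T, add_sub_cancel_left]
      split_ifs with h
      · exact norm_intervalIntegral_antitoneOn_mul_exp_le hK hc h0 h hST hw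
      · rcases le_total 0 T with hT | hT
        · have := hbd T w hT hw
          rw [← hadd w 0 S T] at this
          have h3 := norm_sub_le ((∫ s in (0 : ℝ)..S, (K s : ℂ) *
            Complex.exp (-(Complex.I * s * w))) + ∫ s in S..T, (K s : ℂ) *
            Complex.exp (-(Complex.I * s * w))) (∫ s in (0 : ℝ)..S, (K s : ℂ) *
            Complex.exp (-(Complex.I * s * w)))
          rw [add_sub_cancel_left] at h3
          have : 0 ≤ M * |S| := by positivity
          linarith
        · refine (norm_intervalIntegral_mul_exp_le hST h0 fun t _ => hM t).trans ?_
          have : 0 ≤ C := by positivity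
          rw [abs_of_nonpos (hST.trans hT)]
          have := norm_nonneg (∫ s in (0 : ℝ)..S, (K s : ℂ) *
            Complex.exp (-(Complex.I * s * w)))
          nlinarith
    · have : Tendsto (fun T => 2 * Real.pi * K T) atTop (𝓝 0) := by
        simpa using hlim.const_mul (2 * Real.pi)
      refine this.congr' ?_
      filter_upwards [eventually_ge_atTop A] with T hT
      rw [if_pos hT]
  choose! l hl using hex
  -- cutting the limit off on `|w| < 1` makes it bounded and measurable on the whole line
  refine ⟨C, {w : ℝ | 1 ≤ |w|}.indicator l, by positivity, ?_, ?_, hbd, ?_⟩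
  · have hmeas : MeasurableSet {w : ℝ | 1 ≤ |w|} := measurableSet_le measurable_const (by fun_prop)
    refine measurable_of_tendsto_metrizable (f := fun (n : ℕ) =>
      {w : ℝ | 1 ≤ |w|}.indicator fun w => ∫ s in (0 : ℝ)..n, (K s : ℂ) *
        Complex.exp (-(Complex.I * s * w))) (fun n => ?_) ?_
    · refine Measurable.indicator (Continuous.measurable ?_) hmeas
      exact intervalIntegral.continuous_parametric_intervalIntegral_of_continuous' (by fun_prop) _ _
    · rw [tendsto_pi_nhds]
      intro w
      by_cases hw : 1 ≤ |w|
      · simp only [Set.indicator_of_mem (show w ∈ {w : ℝ | 1 ≤ |w|} from hw)]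
        exact (hl w hw).comp tendsto_natCast_atTop_atTop
      · simp only [Set.indicator_of_notMem (show w ∉ {w : ℝ | 1 ≤ |w|} from hw)]
        exact tendsto_const_nhds
  · intro w
    by_cases hw : 1 ≤ |w|
    · rw [Set.indicator_of_mem (show w ∈ {w : ℝ | 1 ≤ |w|} from hw)]
      refine le_of_tendsto (hl w hw).norm ?_
      filter_upwards [eventually_ge_atTop 0] with T hT using hbd T w hT hw
    · rw [Set.indicator_of_notMem (show w ∉ {w : ℝ | 1 ≤ |w|} from hw), norm_zero]
      positivity
  · intro w hw
    rw [Set.indicator_of_mem (show w ∈ {w : ℝ | 1 ≤ |w|} from hw)]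
    exact hl w hw

/-! ### Functions as tempered distributions -/

theorem exists_isFun_of_bounded {f : ℝ → ℂ} {M : ℝ} (hf : AEStronglyMeasurable f)
    (hb : ∀ t, ‖f t‖ ≤ M) : ∃ T : 𝓢'(ℝ, ℂ), IsFun T f := by
  have hm : MemLp f ⊤ volume := memLp_top_of_bound hf M (Eventually.of_forall hb)
  refine ⟨Lp.toTemperedDistribution hm.toLp, fun φ => ⟨?_, ?_⟩⟩
  · exact φ.integrable.bdd_mul hf (Eventually.of_forall hb)
  · rw [Lp.toTemperedDistribution_apply]
    refine integral_congr_ae ?_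
    filter_upwards [hm.coeFn_toLp] with t ht
    rw [ht, smul_eq_mul, mul_comm]

theorem IsFun.dist_unique {T S : 𝓢'(ℝ, ℂ)} {f : ℝ → ℂ} (hT : IsFun T f) (hS : IsFun S f) :
    T = S := by
  ext φ
  rw [(hT φ).2, (hS φ).2]

theorem IsFun.ofFun_eq {T : 𝓢'(ℝ, ℂ)} {f : ℝ → ℂ} (hT : IsFun T f) : ofFun f = T := by
  have h : ∃ T, IsFun T f := ⟨T, hT⟩
  rw [ofFun, dif_pos h]
  exact h.choose_spec.dist_unique hT

/-- A smooth compactly supported real function, as a complex Schwartz function. -/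
def schwartzOfCompact (g : ℝ → ℝ) (hc : HasCompactSupport g) (hg : ContDiff ℝ (⊤ : ℕ∞) g) :
    𝓢(ℝ, ℂ) :=
  HasCompactSupport.toSchwartzMap (f := fun x => (g x : ℂ))
    (hc.comp_left (g := fun x : ℝ => (x : ℂ)) Complex.ofReal_zero)
    (Complex.ofRealCLM.contDiff.comp hg)

@[simp]
theorem schwartzOfCompact_apply (g : ℝ → ℝ) (hc : HasCompactSupport g)
    (hg : ContDiff ℝ (⊤ : ℕ∞) g) (x : ℝ) : schwartzOfCompact g hc hg x = g x := rfl

/-- A function that represents a tempered distribution is locally integrable, as is seen by testing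
with bumps that are `1` on a given ball. -/
theorem IsFun.locallyIntegrable {T : 𝓢'(ℝ, ℂ)} {f : ℝ → ℂ} (hT : IsFun T f) :
    LocallyIntegrable f := by
  intro x
  let b : ContDiffBump x := ⟨1, 2, one_pos, one_lt_two⟩
  refine ⟨Metric.closedBall x 1, Metric.closedBall_mem_nhds x one_pos, ?_⟩
  have h := (hT (schwartzOfCompact b b.hasCompactSupport b.contDiff)).1.integrableOn
    (s := Metric.closedBall x 1)
  refine h.congr_fun (fun y hy => ?_) measurableSet_closedBall
  simp [b.one_of_mem_closedBall hy]

theorem IsFun.ae_unique {T : 𝓢'(ℝ, ℂ)} {f g : ℝ → ℂ} (hf : IsFun T f) (hg : IsFun T g) :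
    f =ᵐ[volume] g := by
  have h := ae_eq_zero_of_integral_contDiff_smul_eq_zero (μ := (volume : Measure ℝ))
    (f := fun x => f x - g x) (hf.locallyIntegrable.sub hg.locallyIntegrable) (by
      intro χ hχ hc
      have h1 := hf (schwartzOfCompact χ hc hχ)
      have h2 := hg (schwartzOfCompact χ hc hχ)
      have : ∫ x, (f x * schwartzOfCompact χ hc hχ x - g x * schwartzOfCompact χ hc hχ x) = 0 := by
        rw [integral_sub h1.1 h2.1, ← h1.2, ← h2.2, sub_self]
      rw [← this]
      refine integral_congr_ae (Eventually.of_forall fun x => ?_)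
      simp only [schwartzOfCompact_apply, Complex.real_smul]
      ring)
  filter_upwards [h] with x hx using sub_eq_zero.1 hx

/-! ### Real Schwartz functions and the Fourier transform -/

/-- A real Schwartz function regarded as a complex one. -/
def complexify : 𝓢(ℝ, ℝ) →L[ℝ] 𝓢(ℝ, ℂ) := SchwartzMap.postcompCLM Complex.ofRealCLM

@[simp]
theorem complexify_apply (φ : 𝓢(ℝ, ℝ)) (t : ℝ) : complexify φ t = φ t := rfl

/-- The complex conjugate of a Schwartz function. -/
def conjS : 𝓢(ℝ, ℂ) →L[ℝ] 𝓢(ℝ, ℂ) :=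
  SchwartzMap.postcompCLM (Complex.conjCLE : ℂ →L[ℝ] ℂ)

@[simp]
theorem conjS_apply (φ : 𝓢(ℝ, ℂ)) (t : ℝ) : conjS φ t = conj (φ t) := rfl

/-- The reflection of a real Schwartz function. -/
def reflS : 𝓢(ℝ, ℝ) →L[ℝ] 𝓢(ℝ, ℝ) :=
  SchwartzMap.compCLMOfContinuousLinearEquiv ℝ (ContinuousLinearEquiv.neg ℝ)

theorem reflS_coe (φ : 𝓢(ℝ, ℝ)) : (reflS φ : ℝ → ℝ) = refl φ := rfl

theorem continuous_exp_neg_I_mul : Continuous fun p : ℝ × ℝ =>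
    Complex.exp (-(Complex.I * p.1 * p.2)) := by fun_prop

/-- The multiplication formula `∫ φ̂ ψ = ∫ φ ψ̂`. -/
theorem integral_fourierS_mul (φ ψ : 𝓢(ℝ, ℂ)) :
    ∫ w, fourierS φ w * ψ w = ∫ t, φ t * fourierS ψ t := by
  simp only [fourierS_apply, ← integral_mul_const, ← integral_const_mul]
  rw [integral_integral_swap]
  · refine integral_congr_ae (Eventually.of_forall fun t => integral_congr_ae
      (Eventually.of_forall fun w => ?_))
    simp only
    rw [show Complex.I * w * t = Complex.I * t * w by ring]
    ring
  · have h := (ψ.integrable (μ := volume)).mul_prod (φ.integrable (μ := volume))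
    have h2 := h.bdd_mul (c := 1) (f := fun p : ℝ × ℝ => Complex.exp (-(Complex.I * p.2 * p.1)))
      (Continuous.aestronglyMeasurable (by fun_prop))
      (Eventually.of_forall fun p => (norm_exp_neg_I_mul _ _).le)
    refine h2.congr (Eventually.of_forall fun p => ?_)
    simp only [Function.uncurry]
    ring

theorem fourierS_deriv (φ : 𝓢(ℝ, ℂ)) (w : ℝ) :
    fourierS (SchwartzMap.derivCLM ℂ ℂ φ) w = Complex.I * w * fourierS φ w := by
  have h : ∀ φ : 𝓢(ℝ, ℂ),
      fourierS φ w = FourierTransform.fourier (φ : ℝ → ℂ) (w * (2 * Real.pi)⁻¹) := by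
    intro φ; simp [fourierS, scale, SchwartzMap.fourier_coe]
  rw [h, h]
  have h1 : (SchwartzMap.derivCLM ℂ ℂ φ : ℝ → ℂ) = deriv φ := by
    ext x; exact SchwartzMap.derivCLM_apply ℂ φ x
  have h2 : Integrable (deriv φ) := by
    rw [← h1]; exact (SchwartzMap.derivCLM ℂ ℂ φ).integrable
  rw [h1, Real.fourier_deriv φ.integrable φ.differentiable h2]
  simp only [smul_eq_mul]
  have hpi : (Real.pi : ℂ) ≠ 0 := by exact_mod_cast Real.pi_ne_zero
  push_cast
  field_simp

theorem fourierS_conjS_neg (χ : 𝓢(ℝ, ℂ)) (t : ℝ) :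
    fourierS χ (-t) = conj (fourierS (conjS χ) t) := by
  rw [fourierS_apply, fourierS_apply, ← integral_conj]
  refine integral_congr_ae (Eventually.of_forall fun s => ?_)
  simp only [conjS_apply, map_mul, Complex.conj_conj, ← Complex.exp_conj, map_neg, Complex.conj_I,
    Complex.conj_ofReal]
  push_cast
  congr 2
  ring

theorem fourierS_complexify_reflS (φ : 𝓢(ℝ, ℝ)) (w : ℝ) :
    fourierS (complexify (reflS φ)) w = conj (fourierS (complexify φ) w) := by
  rw [fourierS_apply, fourierS_apply, ← integral_conj, ← integral_neg_eq_self]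
  refine integral_congr_ae (Eventually.of_forall fun s => ?_)
  simp only [complexify_apply, map_mul, ← Complex.exp_conj, map_neg, Complex.conj_I,
    Complex.conj_ofReal, reflS_coe, refl, neg_neg]
  push_cast
  congr 2
  ring

theorem IsFun.fourierT_schwartz {T : 𝓢'(ℝ, ℂ)} {φ : 𝓢(ℝ, ℂ)} (hT : IsFun T φ) :
    IsFun (fourierT T) (fourierS φ) := by
  intro χ
  refine ⟨χ.integrable.bdd_mul (c := SchwartzMap.seminorm ℝ 0 0 (fourierS φ))
    (fourierS φ).continuous.aestronglyMeasurable
    (Eventually.of_forall fun w => SchwartzMap.norm_le_seminorm ℝ _ _), ?_⟩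
  rw [fourierT_apply, (hT _).2, integral_fourierS_mul]

/-- For real `f`, the reflection of `f` has the conjugate Fourier transform. -/
theorem IsFun.fourierT_refl {T S : 𝓢'(ℝ, ℂ)} {f : ℝ → ℝ} {G : ℝ → ℂ}
    (hT : IsFun T fun t => (f t : ℂ)) (hS : IsFun S fun t => (refl f t : ℂ))
    (hG : IsFun (fourierT T) G) : IsFun (fourierT S) fun w => conj (G w) := by
  intro χ
  have h := hG (conjS χ)
  refine ⟨?_, ?_⟩
  · have hi := Complex.conjCLE.toContinuousLinearMap.integrable_comp h.1
    refine hi.congr (Eventually.of_forall fun w => ?_)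
    simp
  · rw [fourierT_apply, (hS _).2]
    have h2 := congrArg conj h.2
    rw [fourierT_apply, (hT _).2, ← integral_conj, ← integral_conj] at h2
    rw [← integral_neg_eq_self]
    convert h2 using 1
    · refine integral_congr_ae (Eventually.of_forall fun t => ?_)
      simp only [refl, neg_neg, map_mul, Complex.conj_ofReal, fourierS_conjS_neg]
    · refine integral_congr_ae (Eventually.of_forall fun t => ?_)
      simp

theorem hasTemperateGrowth_of_isSpectralMeasure {ν : Measure ℝ} (hν : IsSpectralMeasure ν) :
    ν.HasTemperateGrowth := by
  obtain ⟨k, hk⟩ := hν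
  refine ⟨⟨2 * k, hk.mono' (Measurable.aestronglyMeasurable (by fun_prop))
    (Eventually.of_forall fun x => ?_)⟩⟩
  have h1 : (1 + x ^ 2) ^ k ≤ (1 + ‖x‖) ^ (2 * k) := by
    rw [pow_mul]
    gcongr
    rw [← sq_abs, Real.norm_eq_abs]
    nlinarith [abs_nonneg x]
  rw [Real.norm_of_nonneg (by positivity)]
  push_cast
  rw [Real.rpow_neg (by positivity), show (2 * (k : ℝ)) = ((2 * k : ℕ) : ℝ) by push_cast; rfl,
    Real.rpow_natCast]
  gcongr

/-! ### The Fourier transform of `K⁺ * φ` away from the origin -/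

theorem conv_eq_integral (f g : ℝ → ℝ) (x : ℝ) : conv f g x = ∫ s, f s * g (x - s) := rfl

theorem fourierS_compSubConst (φ : 𝓢(ℝ, ℂ)) (s w : ℝ) :
    fourierS (φ.compSubConstCLM ℂ s) w = Complex.exp (-(Complex.I * s * w)) * fourierS φ w := by
  rw [fourierS_apply, fourierS_apply, ← integral_const_mul, ← integral_add_right_eq_self _ s]
  refine integral_congr_ae (Eventually.of_forall fun t => ?_)
  simp only [SchwartzMap.compSubConstCLM_apply, add_sub_cancel_right]
  rw [show -(Complex.I * ((t + s : ℝ) : ℂ) * w) = -(Complex.I * s * w) + -(Complex.I * t * w) by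
    push_cast; ring, Complex.exp_add]
  ring

theorem measurable_plus {K : ℝ → ℝ} (hc : Continuous K) : Measurable (plus K) :=
  hc.measurable.indicator measurableSet_Ici

theorem norm_plus_le {K : ℝ → ℝ} {M : ℝ} (h0 : ∀ t, 0 ≤ K t) (hM : ∀ t, K t ≤ M) (t : ℝ) :
    ‖plus K t‖ ≤ M := by
  rw [plus]
  by_cases h : t ∈ Set.Ici (0 : ℝ)
  · rw [Set.indicator_of_mem h, Real.norm_of_nonneg (h0 t)]; exact hM t
  · rw [Set.indicator_of_notMem h, norm_zero]; exact (h0 0).trans (hM 0)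

/-- If `F[K⁺ * φ]` is a function, then away from the origin it is the product of `φ̂` with the
improper Fourier integral of `K⁺`. -/
theorem fourier_conv_plus_ae_eq {K : ℝ → ℝ} {M C : ℝ} {k : ℝ → ℂ} (hc : Continuous K)
    (h0 : ∀ t, 0 ≤ K t) (hM : ∀ t, K t ≤ M) (hkm : Measurable k) (hkC : ∀ w, ‖k w‖ ≤ C)
    (hC : ∀ T w : ℝ, 0 ≤ T → 1 ≤ |w| →
        ‖∫ s in (0 : ℝ)..T, (K s : ℂ) * Complex.exp (-(Complex.I * s * w))‖ ≤ C)
    (hk : ∀ w : ℝ, 1 ≤ |w| → Tendsto (fun T : ℝ => ∫ s in (0 : ℝ)..T, (K s : ℂ) *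
        Complex.exp (-(Complex.I * s * w))) atTop (𝓝 (k w)))
    (φ : 𝓢(ℝ, ℝ)) {T : 𝓢'(ℝ, ℂ)} (hT : IsFun T fun t => (conv (plus K) φ t : ℂ)) {G : ℝ → ℂ}
    (hG : IsFun (fourierT T) G) :
    ∀ᵐ w, 1 < |w| → G w = k w * fourierS (complexify φ) w := by
  have hopen : IsOpen {w : ℝ | 1 < |w|} := isOpen_lt continuous_const continuous_abs
  set Φ := fourierS (complexify φ) with hΦ
  have hli : LocallyIntegrable fun w => k w * Φ w :=
    (Φ.integrable.bdd_mul hkm.aestronglyMeasurable (Eventually.of_forall hkC)).locallyIntegrable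
  have key := hopen.ae_eq_zero_of_integral_contDiff_smul_eq_zero (μ := (volume : Measure ℝ))
    (f := fun w => G w - k w * Φ w)
    ((hG.locallyIntegrable.sub hli).locallyIntegrableOn _) ?_
  · filter_upwards [key] with w hw h using sub_eq_zero.1 (hw h)
  intro g hg hgc hgs
  set χ := schwartzOfCompact g hgc hg with hχ
  have hχ0 : ∀ w : ℝ, ¬ 1 ≤ |w| → χ w = 0 := by
    intro w hw
    have : w ∉ tsupport g := fun h => hw (le_of_lt (hgs h))
    simp [hχ, image_eq_zero_of_notMem_tsupport this]
  have hi1 := (hG χ).1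
  have hχΦ : Integrable fun w => χ w * Φ w :=
    Φ.integrable.bdd_mul (c := SchwartzMap.seminorm ℝ 0 0 χ) χ.continuous.aestronglyMeasurable
      (Eventually.of_forall fun w => SchwartzMap.norm_le_seminorm ℝ _ _)
  have hi2 : Integrable fun w => k w * Φ w * χ w := by
    refine (hχΦ.bdd_mul hkm.aestronglyMeasurable (Eventually.of_forall hkC)).congr
      (Eventually.of_forall fun w => ?_)
    simp only; ring
  suffices h : ∫ w, G w * χ w = ∫ w, k w * Φ w * χ w by
    rw [← sub_eq_zero, ← integral_sub hi1 hi2] at h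
    rw [← h]
    refine integral_congr_ae (Eventually.of_forall fun w => ?_)
    simp only [hχ, schwartzOfCompact_apply, Complex.real_smul]
    ring
  rw [← (hG χ).2, fourierT_apply, (hT _).2]
  set X := fourierS χ with hX
  -- Fubini in the time domain
  have hprod : Integrable (fun p : ℝ × ℝ => (plus K p.2 : ℂ) * (X p.1 * φ (p.1 - p.2)))
      (volume.prod volume) := by
    have hbase : Integrable (fun p : ℝ × ℝ => X p.1 * (φ (p.1 - p.2) : ℂ))
        (volume.prod volume) := by
      have h1 := (X.integrable (μ := volume)).mul_prod
        ((complexify (reflS φ)).integrable (μ := volume))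
      refine ((measurePreserving_prod_sub (volume : Measure ℝ) (volume : Measure ℝ)).integrable_comp
        h1.1 |>.2 h1).congr (Eventually.of_forall fun p => ?_)
      simp [reflS_coe, refl]
    refine hbase.bdd_mul (c := M) ?_ (Eventually.of_forall fun p => ?_)
    · exact (Complex.measurable_ofReal.comp
        ((measurable_plus hc).comp measurable_snd)).aestronglyMeasurable
    · rw [Complex.norm_real]; exact norm_plus_le h0 hM _
  -- `a s = ∫ φ(t - s) χ̂(t) dt`, moved to the frequency side by the multiplication formula
  set a : ℝ → ℂ := fun s => ∫ w : ℝ, Complex.exp (-(Complex.I * s * w)) * (χ w * Φ w) with ha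
  have hinner : ∀ s : ℝ, ∫ t, (plus K s : ℂ) * (X t * φ (t - s)) = plus K s * a s := by
    intro s
    rw [integral_const_mul]
    congr 1
    have := integral_fourierS_mul ((complexify φ).compSubConstCLM ℂ s) χ
    calc ∫ t, X t * (φ (t - s) : ℂ)
        = ∫ t, ((complexify φ).compSubConstCLM ℂ s) t * fourierS χ t := by
          refine integral_congr_ae (Eventually.of_forall fun t => ?_)
          simp [hX, mul_comm]
      _ = a s := by
          rw [← this]
          refine integral_congr_ae (Eventually.of_forall fun w => ?_)
          simp only [fourierS_compSubConst]
          ring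
  have hA : ∫ t, (conv (plus K) φ t : ℂ) * X t = ∫ s, (plus K s : ℂ) * a s := by
    simp only [← hinner]
    rw [integral_integral_swap (f := fun s t => (plus K s : ℂ) * (X t * φ (t - s)))]
    · refine integral_congr_ae (Eventually.of_forall fun t => ?_)
      simp only [conv_eq_integral]
      rw [← integral_complex_ofReal, ← integral_mul_const]
      refine integral_congr_ae (Eventually.of_forall fun s => ?_)
      push_cast; ring
    · exact hprod.swap
  have hai : Integrable fun s => (plus K s : ℂ) * a s := by
    simp only [← hinner]
    exact hprod.integral_prod_right
  rw [hA]
  have hA2 : ∫ s, (plus K s : ℂ) * a s = ∫ s in Set.Ioi (0 : ℝ), (K s : ℂ) * a s := by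
    rw [← integral_Ici_eq_integral_Ioi, ← integral_indicator measurableSet_Ici]
    refine integral_congr_ae (Eventually.of_forall fun s => ?_)
    simp only [plus, Set.indicator]
    split_ifs <;> simp
  have haiO : IntegrableOn (fun s => (K s : ℂ) * a s) (Set.Ioi 0) := by
    refine (hai.integrableOn (s := Set.Ioi 0)).congr_fun (fun s hs => ?_) measurableSet_Ioi
    simp only [plus, Set.indicator_of_mem (Set.mem_Ici.2 (le_of_lt (Set.mem_Ioi.1 hs)))]
  have hlim1 := intervalIntegral_tendsto_integral_Ioi 0 haiO tendsto_id
  rw [hA2]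
  refine tendsto_nhds_unique hlim1 ?_
  -- Fubini in the frequency domain
  have hsw : ∀ T : ℝ, 0 ≤ T → ∫ s in (0 : ℝ)..T, (K s : ℂ) * a s =
      ∫ w : ℝ, (∫ s in (0 : ℝ)..T, (K s : ℂ) * Complex.exp (-(Complex.I * s * w))) * (χ w * Φ w) := by
    intro T hT
    simp only [ha, ← integral_const_mul, intervalIntegral.integral_of_le hT, ← integral_mul_const]
    rw [integral_integral_swap]
    · simp only [mul_assoc]
    · have hK1 : Integrable (fun s => (K s : ℂ)) (volume.restrict (Set.Ioc 0 T)) := by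
        have : Continuous fun s => (K s : ℂ) := by fun_prop
        exact (this.integrableOn_Icc (a := 0) (b := T)).mono_set Set.Ioc_subset_Icc_self
      refine ((hK1.mul_prod hχΦ).bdd_mul (c := 1)
        continuous_exp_neg_I_mul.aestronglyMeasurable
        (Eventually.of_forall fun p => (norm_exp_neg_I_mul _ _).le)).congr
        (Eventually.of_forall fun p => ?_)
      simp only [Function.uncurry]
      ring
  have hlim2 : Tendsto (fun T : ℝ => ∫ w : ℝ, (∫ s in (0 : ℝ)..T, (K s : ℂ) *
      Complex.exp (-(Complex.I * s * w))) * (χ w * Φ w)) atTop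
      (𝓝 (∫ w, k w * Φ w * χ w)) := by
    refine tendsto_integral_filter_of_dominated_convergence (fun w => C * ‖χ w * Φ w‖) ?_ ?_
      (hχΦ.norm.const_mul C) ?_
    · refine Eventually.of_forall fun T => ?_
      refine AEStronglyMeasurable.mul (Continuous.aestronglyMeasurable ?_) hχΦ.1
      exact intervalIntegral.continuous_parametric_intervalIntegral_of_continuous' (by fun_prop) _ _
    · filter_upwards [eventually_ge_atTop 0] with T hT
      refine Eventually.of_forall fun w => ?_
      by_cases hw : 1 ≤ |w|
      · rw [norm_mul]
        exact mul_le_mul_of_nonneg_right (hC T w hT hw) (norm_nonneg _)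
      · simp [hχ0 w hw]
    · refine Eventually.of_forall fun w => ?_
      by_cases hw : 1 ≤ |w|
      · rw [show k w * Φ w * χ w = k w * (χ w * Φ w) by ring]
        exact (hk w hw).mul_const _
      · simp [hχ0 w hw]
  refine hlim2.congr' ?_
  filter_upwards [eventually_ge_atTop 0] with T hT using (hsw T hT).symm

/-! ### The energy inequality for test functions -/

theorem IsFun.add {T S : 𝓢'(ℝ, ℂ)} {f g : ℝ → ℂ} (hT : IsFun T f) (hS : IsFun S g) :
    IsFun (T + S) fun t => f t + g t := by
  intro χ
  have h1 := hT χ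
  have h2 := hS χ
  refine ⟨(h1.1.add h2.1).congr (Eventually.of_forall fun t => ?_), ?_⟩
  · simp only [Pi.add_apply]; ring
  · rw [add_apply, h1.2, h2.2, ← integral_add h1.1 h2.1]
    refine integral_congr_ae (Eventually.of_forall fun t => ?_)
    simp only; ring

theorem IsFun.smul {T : 𝓢'(ℝ, ℂ)} {f : ℝ → ℂ} (c : ℂ) (hT : IsFun T f) :
    IsFun (c • T) fun t => c * f t := by
  intro χ
  have h1 := hT χ
  refine ⟨(h1.1.const_mul c).congr (Eventually.of_forall fun t => ?_), ?_⟩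
  · simp only; ring
  · rw [smul_apply, h1.2, smul_eq_mul, ← integral_const_mul]
    refine integral_congr_ae (Eventually.of_forall fun t => ?_)
    simp only; ring

theorem fourierT_add (T S : 𝓢'(ℝ, ℂ)) : fourierT (T + S) = fourierT T + fourierT S := by
  ext χ; rfl

theorem fourierT_smul (c : ℂ) (T : 𝓢'(ℝ, ℂ)) : fourierT (c • T) = c • fourierT T := by
  ext χ; rfl

/-- The operator at `g` is the stochastic integral of the conjugate of any function representing
`F[g]`. -/
theorem RandomMeasure.op_eq (ξ : RandomMeasure ν P) (hac : ν ≪ volume) {g : 𝓢'(ℝ, ℂ)} {G : ℝ → ℂ}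
    (hG : IsFun (fourierT g) G) (hG2 : MemLp G 2 ν) :
    ξ.op g = ξ.integral (hG2.star.toLp (star G)) := by
  have h : g ∈ Dom ν := ⟨G, hG, hG2⟩
  rw [RandomMeasure.op, dif_pos h]
  congr 1
  rw [MemLp.toLp_eq_toLp_iff]
  filter_upwards [hac.ae_le (h.choose_spec.1.ae_unique hG)] with w hw
  simp [hw]

theorem integral_mul_conj_self (Z : Lp ℂ 2 P) : ∫ x, Z x * conj (Z x) ∂P = ((‖Z‖ ^ 2 : ℝ) : ℂ) := by
  have h : inner ℂ Z Z = ∫ x, Z x * conj (Z x) ∂P := by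
    rw [L2.inner_def]
    rfl
  rw [← h, inner_self_eq_norm_sq_to_K]
  norm_cast

theorem norm_sq_eq_integral (Z : Lp ℂ 2 P) : ‖Z‖ ^ 2 = ∫ x, ‖Z x‖ ^ 2 ∂P := by
  have h := integral_mul_conj_self Z
  simp only [Complex.mul_conj, Complex.normSq_eq_norm_sq] at h
  rw [integral_complex_ofReal] at h
  exact_mod_cast h.symm

theorem norm_conv_plus_le {K : ℝ → ℝ} {M : ℝ} (h0 : ∀ t, 0 ≤ K t) (hM : ∀ t, K t ≤ M)
    (φ : 𝓢(ℝ, ℝ)) (t : ℝ) : ‖conv (plus K) φ t‖ ≤ M * ∫ s, ‖φ s‖ := by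
  rw [conv_eq_integral, ← integral_sub_left_eq_self (fun s => ‖φ s‖) volume t, ← integral_const_mul]
  refine norm_integral_le_of_norm_le ((φ.integrable.norm.comp_sub_left t).const_mul M)
    (Eventually.of_forall fun s => ?_)
  rw [norm_mul]
  exact mul_le_mul_of_nonneg_right (norm_plus_le h0 hM s) (norm_nonneg _)

/-- The Fourier transform of the test function `-m φ' + β (K⁺ * φ̃)~` is a function in `L²(ν)`; at
high frequencies the inertial term `-m φ'` dominates the friction term. -/
theorem exists_fourier_testFun {m β C : ℝ} {K : ℝ → ℝ} {k : ℝ → ℂ} {M : ℝ}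
    (hm : 0 < m) (hβ : 0 < β)
    (hν : IsSpectralMeasure ν) (hc : Continuous K)
    (h0 : ∀ t, 0 ≤ K t) (hM : ∀ t, K t ≤ M) (hkm : Measurable k) (hkC : ∀ w, ‖k w‖ ≤ C)
    (hC : ∀ T w : ℝ, 0 ≤ T → 1 ≤ |w| →
        ‖∫ s in (0 : ℝ)..T, (K s : ℂ) * Complex.exp (-(Complex.I * s * w))‖ ≤ C)
    (hk : ∀ w : ℝ, 1 ≤ |w| → Tendsto (fun T : ℝ => ∫ s in (0 : ℝ)..T, (K s : ℂ) *
        Complex.exp (-(Complex.I * s * w))) atTop (𝓝 (k w)))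
    (hdom : ∀ φ : 𝓢(ℝ, ℝ), ∃ T ∈ Dom ν, IsFun T fun t => (conv (plus K) φ t : ℂ))
    (φ : 𝓢(ℝ, ℝ)) :
    ∃ (T : 𝓢'(ℝ, ℂ)) (H : ℝ → ℂ), IsFun T (fun t => (testFun m 0 β K φ t : ℂ)) ∧
      IsFun (fourierT T) H ∧ MemLp H 2 ν ∧
      ∀ᵐ w, 1 < |w| → (m * |w| - β * C) * ‖fourierS (complexify φ) w‖ ≤ ‖H w‖ := by
  obtain ⟨S, ⟨G, hG, hG2⟩, hS⟩ := hdom (reflS φ)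
  have hGk := fourier_conv_plus_ae_eq hc h0 hM hkm hkC hC hk (reflS φ) hS hG
  have hmeas : Measurable (conv (plus K) (reflS φ)) := by
    have : StronglyMeasurable fun p : ℝ × ℝ => plus K p.2 * (reflS φ) (p.1 - p.2) :=
      (((measurable_plus hc).comp measurable_snd).mul ((reflS φ).continuous.measurable.comp
        (measurable_fst.sub measurable_snd))).stronglyMeasurable
    exact this.integral_prod_right.measurable
  obtain ⟨S', hS'⟩ := exists_isFun_of_bounded
    (f := fun t => (refl (conv (plus K) (reflS φ)) t : ℂ)) (M := M * ∫ s, ‖reflS φ s‖)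
    (Complex.measurable_ofReal.comp (hmeas.comp measurable_neg)).aestronglyMeasurable
    (fun t => by rw [Complex.norm_real]; exact norm_conv_plus_le h0 hM _ _)
  have hG' := hS.fourierT_refl hS' hG
  set D : 𝓢(ℝ, ℂ) := SchwartzMap.derivCLM ℂ ℂ (complexify φ) with hD
  have hDb : ∀ t, ‖D t‖ ≤ SchwartzMap.seminorm ℝ 0 0 D := SchwartzMap.norm_le_seminorm ℝ D
  obtain ⟨R, hR⟩ := exists_isFun_of_bounded D.continuous.aestronglyMeasurable hDb
  have hDφ : ∀ t, D t = ((deriv φ t : ℝ) : ℂ) := fun t => by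
    rw [hD, SchwartzMap.derivCLM_apply]
    exact (φ.hasDerivAt t).ofReal_comp.deriv
  have hRF := hR.fourierT_schwartz
  have := hasTemperateGrowth_of_isSpectralMeasure hν
  refine ⟨(-m : ℂ) • R + (β : ℂ) • S',
    fun w => (-m : ℂ) * fourierS D w + (β : ℂ) * conj (G w), ?_, ?_, ?_, ?_⟩
  · have h := (hR.smul (-m : ℂ)).add (hS'.smul (β : ℂ))
    convert h using 2 with t
    simp only [testFun, hDφ, reflS_coe]
    push_cast
    ring
  · rw [fourierT_add, fourierT_smul, fourierT_smul]
    exact (hRF.smul (-m : ℂ)).add (hG'.smul (β : ℂ))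
  · exact (((fourierS D).memLp 2 ν).const_mul (-m : ℂ)).add (hG2.star.const_mul (β : ℂ))
  · filter_upwards [hGk] with w hw h1
    rw [hw h1, fourierS_complexify_reflS, hD, fourierS_deriv]
    have e1 : ‖(-m : ℂ) * (Complex.I * w * fourierS (complexify φ) w)‖ =
        m * |w| * ‖fourierS (complexify φ) w‖ := by
      rw [norm_mul, norm_mul, norm_mul, norm_neg, Complex.norm_real, Complex.norm_I,
        Complex.norm_real, Real.norm_of_nonneg hm.le, Real.norm_eq_abs]
      ring
    have e2 : ‖(β : ℂ) * conj (k w * conj (fourierS (complexify φ) w))‖ ≤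
        β * C * ‖fourierS (complexify φ) w‖ := by
      rw [norm_mul, RCLike.norm_conj, norm_mul, RCLike.norm_conj, Complex.norm_real,
        Real.norm_of_nonneg hβ.le, mul_assoc]
      gcongr
      exact hkC w
    have e3 := norm_sub_le_norm_add ((-m : ℂ) * (Complex.I * w * fourierS (complexify φ) w))
      ((β : ℂ) * conj (k w * conj (fourierS (complexify φ) w)))
    rw [e1] at e3
    linarith

/-- The covariance of the weak solution controls the high-frequency part of `φ̂` in `L²(ω² dν)` by
the energy of the noise. -/
theorem IsWeakSolution.exists_energy_le {m β M A : ℝ} {K : ℝ → ℝ} (hm : 0 < m) (hβ : 0 < β)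
    (hν : IsSpectralMeasure ν) (hac : ν ≪ volume) (hc : Continuous K) (h0 : ∀ t, 0 ≤ K t)
    (hM : ∀ t, K t ≤ M) (hA : AntitoneOn K (Set.Ici A)) (hlim : Tendsto K atTop (𝓝 0))
    {W F : 𝓢(ℝ, ℝ) →ₗ[ℝ] Lp ℂ 2 P'} (hF : HasCovariance K F) {ξ : RandomMeasure ν P}
    (hV : IsWeakSolution m 0 β K W F ξ) :
    ∃ R : ℝ, 0 < R ∧ ∀ φ : 𝓢(ℝ, ℝ),
      ∫⁻ w in {w : ℝ | R < |w|}, ENNReal.ofReal ((m / 2 * |w|) ^ 2 *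
          ‖fourierS (complexify φ) w‖ ^ 2) ∂ν ≤
        ENNReal.ofReal (β * ∫ t, K t * conv φ (refl φ) t) := by
  obtain ⟨C, k, hC0, hkm, hkC, hC, hk⟩ := exists_oscillatory_limit hA hc h0 hM hlim
  -- beyond this radius `β * C ≤ m * |w| / 2`
  refine ⟨max 1 (2 * β * C / m), by positivity, fun φ => ?_⟩
  obtain ⟨T, H, hT, hTH, hH2, hH⟩ := exists_fourier_testFun hm hβ hν hc h0 hM hkm hkC hC hk
    hV.mem_dom φ
  have h1 := hV.covariance_eq φ φ
  rw [hT.ofFun_eq, ξ.op_eq hac hTH hH2, integral_mul_conj_self, ξ.norm_integral] at h1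
  have h2 : ∫ x, (Real.sqrt (2 * 0) • W φ + Real.sqrt β • F φ) x
        * conj ((Real.sqrt (2 * 0) • W φ + Real.sqrt β • F φ) x) ∂P' =
      ((β * ∫ t, K t * conv φ (refl φ) t : ℝ) : ℂ) := by
    rw [mul_zero, Real.sqrt_zero, zero_smul, zero_add, integral_mul_conj_self, norm_smul, mul_pow,
      Complex.ofReal_mul, ← integral_mul_conj_self, hF φ φ, Complex.ofReal_mul]
    congr 2
    rw [Real.norm_of_nonneg (Real.sqrt_nonneg _), Real.sq_sqrt hβ.le]
  rw [h2] at h1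
  have h3 : ‖hH2.star.toLp (star H)‖ ^ 2 = β * ∫ t, K t * conv φ (refl φ) t := by
    exact_mod_cast h1
  rw [← h3, Lp.norm_toLp]
  have h4 : ENNReal.ofReal ((eLpNorm (star H) 2 ν).toReal ^ 2) = ∫⁻ w, ‖H w‖ₑ ^ 2 ∂ν := by
    rw [ENNReal.ofReal_pow ENNReal.toReal_nonneg, ENNReal.ofReal_toReal hH2.star.2.ne,
      eLpNorm_eq_lintegral_rpow_enorm_toReal two_ne_zero ENNReal.ofNat_ne_top]
    rw [← ENNReal.rpow_natCast, ← ENNReal.rpow_mul]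
    simp [enorm_eq_nnnorm]
  rw [h4]
  refine (lintegral_mono_ae ?_).trans (setLIntegral_le_lintegral _ _)
  refine (ae_restrict_iff' (measurableSet_lt measurable_const (by fun_prop))).2 ?_
  filter_upwards [hac.ae_le hH] with w hw hR
  replace hR := max_lt_iff.1 hR
  have h5 := hw hR.1
  have h6 : 2 * β * C < |w| * m := by rw [← div_lt_iff₀ hm]; exact hR.2
  rw [← ofReal_norm, ← ENNReal.ofReal_pow (norm_nonneg _), ← mul_pow]
  refine ENNReal.ofReal_le_ofReal ?_
  gcongr
  refine le_trans ?_ h5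
  gcongr
  linarith

/-! ### Schwartz approximations of point masses -/

/-- A smooth bump with integral `1`, supported in `[-2, 2]`. -/
def mollifier : ℝ → ℝ := (⟨1, 2, one_pos, one_lt_two⟩ : ContDiffBump (0 : ℝ)).normed volume

theorem mollifier_hasCompactSupport : HasCompactSupport mollifier :=
  ContDiffBump.hasCompactSupport_normed _

theorem mollifier_contDiff : ContDiff ℝ (⊤ : ℕ∞) mollifier := ContDiffBump.contDiff_normed _

theorem integral_mollifier : ∫ x, mollifier x = 1 := ContDiffBump.integral_normed _

theorem integrable_mollifier : Integrable mollifier := ContDiffBump.integrable_normed _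

/-- The Schwartz function `x ↦ (n + 1) g((n + 1) x)`, where `g` is the mollifier. -/
def mollifierSeq (n : ℕ) : 𝓢(ℝ, ℝ) :=
  ((n : ℝ) + 1) • SchwartzMap.compCLMOfContinuousLinearEquiv ℝ
    (ContinuousLinearEquiv.unitsEquivAut ℝ (Units.mk0 ((n : ℝ) + 1) (by positivity)))
    (HasCompactSupport.toSchwartzMap mollifier_hasCompactSupport mollifier_contDiff)

theorem mollifierSeq_apply (n : ℕ) (x : ℝ) :
    mollifierSeq n x = ((n : ℝ) + 1) * mollifier (x * ((n : ℝ) + 1)) := rfl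

/-- A Schwartz approximation of `c₀ δ_0 + c₁ δ_t`. -/
def twoPointSeq (c₀ c₁ t : ℝ) (n : ℕ) : 𝓢(ℝ, ℝ) :=
  c₀ • mollifierSeq n + c₁ • (mollifierSeq n).compSubConstCLM ℝ t

theorem twoPointSeq_apply (c₀ c₁ t : ℝ) (n : ℕ) (x : ℝ) :
    twoPointSeq c₀ c₁ t n x = c₀ * mollifierSeq n x + c₁ * mollifierSeq n (x - t) := rfl

theorem integral_mollifierSeq_smul {E : Type*} [NormedAddCommGroup E] [NormedSpace ℝ E]
    (n : ℕ) (f : ℝ → E) :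
    ∫ x, mollifierSeq n x • f x = ∫ x, mollifier x • f (x / (n + 1)) := by
  have hn : (0 : ℝ) < (n : ℝ) + 1 := by positivity
  have h := Measure.integral_comp_mul_right (fun y => mollifier y • f (y / (n + 1))) ((n : ℝ) + 1)
  rw [abs_of_pos (inv_pos.2 hn)] at h
  rw [eq_inv_smul_iff₀ hn.ne'] at h
  rw [← h, ← integral_smul]
  refine integral_congr_ae (Eventually.of_forall fun x => ?_)
  simp only [mollifierSeq_apply, mul_smul]
  rw [mul_div_cancel_right₀ _ hn.ne']

theorem integral_twoPointSeq_smul {E : Type*} [NormedAddCommGroup E] [NormedSpace ℝ E]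
    (c₀ c₁ t : ℝ) (n : ℕ) {f : ℝ → E} (hf : AEStronglyMeasurable f) {B : ℝ}
    (hB : ∀ x, ‖f x‖ ≤ B) :
    ∫ x, twoPointSeq c₀ c₁ t n x • f x = c₀ • (∫ x, mollifier x • f (x / (n + 1))) +
      c₁ • ∫ x, mollifier x • f (x / (n + 1) + t) := by
  have hi : Integrable fun x => mollifierSeq n x • f x :=
    (mollifierSeq n).integrable.smul_bdd B hf (Eventually.of_forall hB)
  have hi2 : Integrable fun x => mollifierSeq n (x - t) • f x :=
    ((mollifierSeq n).integrable.comp_sub_right t).smul_bdd B hf (Eventually.of_forall hB)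
  simp only [twoPointSeq_apply, add_smul, mul_smul]
  rw [integral_add (by exact hi.smul c₀) (by exact hi2.smul c₁), integral_smul, integral_smul,
    integral_mollifierSeq_smul]
  congr 2
  rw [← integral_add_right_eq_self _ t]
  simp only [add_sub_cancel_right]
  exact integral_mollifierSeq_smul n fun x => f (x + t)

/-- The integrands may vary with `n`, which allows the limit of the double integral
`∬ K(s - y) φ(s) φ(y)` to be taken one variable at a time. -/
theorem tendsto_integral_twoPointSeq {E : Type*} [NormedAddCommGroup E] [NormedSpace ℝ E]
    [CompleteSpace E] (c₀ c₁ t : ℝ) {f : ℕ → ℝ → E} {B : ℝ} {a b : E} (hf : ∀ n, Continuous (f n))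
    (hB : ∀ n x, ‖f n x‖ ≤ B)
    (ha : ∀ x, Tendsto (fun n : ℕ => f n (x / (n + 1))) atTop (𝓝 a))
    (hb : ∀ x, Tendsto (fun n : ℕ => f n (x / (n + 1) + t)) atTop (𝓝 b)) :
    Tendsto (fun n => ∫ x, twoPointSeq c₀ c₁ t n x • f n x) atTop (𝓝 (c₀ • a + c₁ • b)) := by
  have key : ∀ (h : ℕ → ℝ → E) (c : E), (∀ n, Continuous (h n)) → (∀ n x, ‖h n x‖ ≤ B) →
      (∀ x, Tendsto (fun n : ℕ => h n x) atTop (𝓝 c)) →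
      Tendsto (fun n => ∫ x, mollifier x • h n x) atTop (𝓝 c) := by
    intro h c hh hhB hc
    have : c = ∫ x, mollifier x • c := by
      rw [integral_smul_const, integral_mollifier, one_smul]
    conv => rhs; rw [this]
    refine tendsto_integral_of_dominated_convergence (fun x => ‖mollifier x‖ * B) (fun n => ?_)
      (integrable_mollifier.norm.mul_const B) (fun n => Eventually.of_forall fun x => ?_)
      (Eventually.of_forall fun x => (hc x).const_smul _)
    · exact (mollifier_contDiff.continuous.smul (hh n)).aestronglyMeasurable
    · rw [norm_smul]
      exact mul_le_mul_of_nonneg_left (hhB n x) (norm_nonneg _)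
  simp only [fun n => integral_twoPointSeq_smul c₀ c₁ t n (hf n).aestronglyMeasurable (hB n)]
  refine Tendsto.add (Tendsto.const_smul ?_ _) (Tendsto.const_smul ?_ _)
  · exact key (fun n x => f n (x / (n + 1))) a (fun n => (hf n).comp (by fun_prop))
      (fun n x => hB n _) ha
  · exact key (fun n x => f n (x / (n + 1) + t)) b (fun n => (hf n).comp (by fun_prop))
      (fun n x => hB n _) hb

theorem tendsto_div_nat_add_one (x : ℝ) :
    Tendsto (fun n : ℕ => x / ((n : ℝ) + 1)) atTop (𝓝 0) := by
  simpa [div_eq_mul_inv] using (tendsto_one_div_add_atTop_nhds_zero_nat (𝕜 := ℝ)).const_mul x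

theorem tendsto_fourierS_twoPointSeq (c₀ c₁ t w : ℝ) :
    Tendsto (fun n => fourierS (complexify (twoPointSeq c₀ c₁ t n)) w) atTop
      (𝓝 (c₀ + c₁ * Complex.exp (-(Complex.I * t * w)))) := by
  have hcont : Continuous fun x : ℝ => Complex.exp (-(Complex.I * x * w)) := by fun_prop
  have h := tendsto_integral_twoPointSeq c₀ c₁ t
    (f := fun _ x => Complex.exp (-(Complex.I * x * w))) (B := 1) (a := 1)
    (b := Complex.exp (-(Complex.I * t * w))) (fun _ => hcont)
    (fun _ x => (norm_exp_neg_I_mul x w).le) (fun x => by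
      have := (hcont.tendsto 0).comp (tendsto_div_nat_add_one x)
      simpa [Function.comp_def] using this) (fun x => by
      have := (hcont.tendsto t).comp (by simpa using (tendsto_div_nat_add_one x).add_const t)
      simpa [Function.comp_def] using this)
  simp only [fourierS_apply, complexify_apply]
  simpa only [Complex.real_smul, mul_one] using h

theorem integral_mul_conv_refl {K : ℝ → ℝ} {M : ℝ} (hc : Continuous K) (hM : ∀ t, ‖K t‖ ≤ M)
    (φ : 𝓢(ℝ, ℝ)) :
    ∫ u, K u * conv φ (refl φ) u = ∫ s, φ s * ∫ y, φ y * K (s - y) := by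
  simp only [conv_eq_integral, refl, neg_sub, ← integral_const_mul]
  rw [integral_integral_swap]
  · refine integral_congr_ae (Eventually.of_forall fun s => ?_)
    simp only
    rw [← integral_sub_left_eq_self _ volume s]
    refine integral_congr_ae (Eventually.of_forall fun y => ?_)
    simp only [sub_sub_cancel]
    ring
  · have h1 := (φ.integrable (μ := volume)).mul_prod ((reflS φ).integrable (μ := volume))
    have h2 := ((measurePreserving_prod_sub (volume : Measure ℝ) (volume : Measure ℝ)).integrable_comp
      h1.1 |>.2 h1)
    refine ((h2.bdd_mul (c := M) (f := fun p : ℝ × ℝ => K p.2)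
      (hc.comp continuous_snd).aestronglyMeasurable
      (Eventually.of_forall fun p => hM _)).swap).congr (Eventually.of_forall fun p => ?_)
    simp [reflS_coe, refl, Function.uncurry]

/-- The energy of the noise converges to `∑ cⱼ cₖ K(tⱼ - tₖ)` over the two point masses. -/
theorem tendsto_integral_mul_conv_twoPointSeq {K : ℝ → ℝ} {M : ℝ} (hc : Continuous K)
    (hM : ∀ t, ‖K t‖ ≤ M) (hs : ∀ t, K (-t) = K t) (c₀ c₁ t : ℝ) :
    Tendsto (fun n => ∫ u, K u * conv (twoPointSeq c₀ c₁ t n) (refl (twoPointSeq c₀ c₁ t n)) u)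
      atTop (𝓝 ((c₀ ^ 2 + c₁ ^ 2) * K 0 + 2 * c₀ * c₁ * K t)) := by
  simp only [fun n => integral_mul_conv_refl hc hM (twoPointSeq c₀ c₁ t n)]
  set L : ℕ → ℝ → ℝ := fun n s => ∫ y, twoPointSeq c₀ c₁ t n y • K (s - y) with hL
  have hdiv : ∀ x : ℝ, Tendsto (fun n : ℕ => x / ((n : ℝ) + 1) + t) atTop (𝓝 t) := fun x => by
    simpa using (tendsto_div_nat_add_one x).add_const t
  have hLlim : ∀ (s : ℕ → ℝ) (s₀ : ℝ), Tendsto s atTop (𝓝 s₀) →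
      Tendsto (fun n => L n (s n)) atTop (𝓝 (c₀ * K s₀ + c₁ * K (s₀ - t))) := by
    intro s s₀ hs₀
    refine tendsto_integral_twoPointSeq c₀ c₁ t (f := fun n y => K (s n - y)) (B := M)
      (fun n => by fun_prop) (fun n x => hM _) (fun x => ?_) (fun x => ?_)
    · refine (hc.tendsto s₀).comp ?_
      simpa using hs₀.sub (tendsto_div_nat_add_one x)
    · exact (hc.tendsto (s₀ - t)).comp (hs₀.sub (hdiv x))
  have hLc : ∀ n, Continuous (L n) := by
    intro n
    refine continuous_of_dominated (bound := fun y => ‖twoPointSeq c₀ c₁ t n y‖ * M) (fun s => ?_)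
      (fun s => Eventually.of_forall fun y => ?_)
      ((twoPointSeq c₀ c₁ t n).integrable.norm.mul_const M)
      (Eventually.of_forall fun y => by fun_prop)
    · exact Continuous.aestronglyMeasurable (by fun_prop)
    · rw [norm_smul]
      exact mul_le_mul_of_nonneg_left (hM _) (norm_nonneg _)
  have hMn : Integrable fun x => ‖mollifier x‖ * M := integrable_mollifier.norm.mul_const M
  have hLb : ∀ n s, ‖L n s‖ ≤ (|c₀| + |c₁|) * ∫ x, ‖mollifier x‖ * M := by
    intro n s
    have hcs : Continuous fun y => K (s - y) := by fun_prop
    simp only [hL]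
    rw [integral_twoPointSeq_smul c₀ c₁ t n hcs.aestronglyMeasurable
      (fun y => hM (s - y)), add_mul]
    have hb : ∀ f : ℝ → ℝ, ‖∫ x, mollifier x • K (f x)‖ ≤ ∫ x, ‖mollifier x‖ * M := fun f =>
      norm_integral_le_of_norm_le hMn (Eventually.of_forall fun x => by
        rw [norm_smul]
        exact mul_le_mul_of_nonneg_left (hM _) (norm_nonneg _))
    refine (norm_add_le _ _).trans (add_le_add ?_ ?_)
    · rw [norm_smul, Real.norm_eq_abs]
      exact mul_le_mul_of_nonneg_left (hb _) (abs_nonneg _)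
    · rw [norm_smul, Real.norm_eq_abs]
      exact mul_le_mul_of_nonneg_left (hb _) (abs_nonneg _)
  have h := tendsto_integral_twoPointSeq c₀ c₁ t (f := L) hLc hLb
    (fun x => hLlim _ 0 (tendsto_div_nat_add_one x)) (fun x => hLlim _ t (hdiv x))
  have he : (c₀ ^ 2 + c₁ ^ 2) * K 0 + 2 * c₀ * c₁ * K t =
      c₀ • (c₀ * K 0 + c₁ * K (0 - t)) + c₁ • (c₀ * K t + c₁ * K (t - t)) := by
    simp only [smul_eq_mul, zero_sub, sub_self, hs]
    ring
  rw [he]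
  exact h

/-! ### Moments of the spectral measure -/

/-- The energy inequality passes to two-point combinations of point masses, by Fatou's lemma. -/
theorem lintegral_twoPoint_le {m β R M : ℝ} {K : ℝ → ℝ} (hc : Continuous K)
    (hM : ∀ t, ‖K t‖ ≤ M) (hs : ∀ t, K (-t) = K t)
    (hE : ∀ φ : 𝓢(ℝ, ℝ),
      ∫⁻ w in {w : ℝ | R < |w|}, ENNReal.ofReal ((m / 2 * |w|) ^ 2 *
          ‖fourierS (complexify φ) w‖ ^ 2) ∂ν ≤
        ENNReal.ofReal (β * ∫ t, K t * conv φ (refl φ) t)) (c₀ c₁ t : ℝ) :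
    ∫⁻ w in {w : ℝ | R < |w|}, ENNReal.ofReal ((m / 2 * |w|) ^ 2 *
        ‖(c₀ : ℂ) + c₁ * Complex.exp (-(Complex.I * t * w))‖ ^ 2) ∂ν ≤
      ENNReal.ofReal (β * ((c₀ ^ 2 + c₁ ^ 2) * K 0 + 2 * c₀ * c₁ * K t)) := by
  set f : ℕ → ℝ → ℝ≥0∞ := fun n w => ENNReal.ofReal ((m / 2 * |w|) ^ 2 *
    ‖fourierS (complexify (twoPointSeq c₀ c₁ t n)) w‖ ^ 2) with hf
  have hlim : ∀ w, Tendsto (fun n => f n w) atTop (𝓝 (ENNReal.ofReal ((m / 2 * |w|) ^ 2 *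
        ‖(c₀ : ℂ) + c₁ * Complex.exp (-(Complex.I * t * w))‖ ^ 2))) := fun w =>
    ENNReal.tendsto_ofReal (((tendsto_fourierS_twoPointSeq c₀ c₁ t w).norm.pow 2).const_mul _)
  have hmeas : ∀ n, Measurable (f n) := by
    intro n
    have := (fourierS (complexify (twoPointSeq c₀ c₁ t n))).continuous
    exact ENNReal.measurable_ofReal.comp (Continuous.measurable (by fun_prop))
  calc _ = ∫⁻ w in {w : ℝ | R < |w|}, liminf (fun n => f n w) atTop ∂ν :=
        lintegral_congr fun w => (hlim w).liminf_eq.symm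
    _ ≤ liminf (fun n => ∫⁻ w in {w : ℝ | R < |w|}, f n w ∂ν) atTop :=
        lintegral_liminf_le hmeas
    _ ≤ liminf (fun n => ENNReal.ofReal (β * ∫ u, K u * conv (twoPointSeq c₀ c₁ t n)
          (refl (twoPointSeq c₀ c₁ t n)) u)) atTop :=
        liminf_le_liminf (Eventually.of_forall fun n => hE _)
    _ = _ := (ENNReal.tendsto_ofReal
        ((tendsto_integral_mul_conv_twoPointSeq hc hM hs c₀ c₁ t).const_mul β)).liminf_eq

theorem IsSpectralMeasure.measure_abs_le_lt_top (hν : IsSpectralMeasure ν) (R : ℝ) :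
    ν {w : ℝ | |w| ≤ R} < ⊤ := by
  obtain ⟨k, hk⟩ := hν
  have h := hk.measure_norm_ge_lt_top (ε := ((1 + R ^ 2) ^ k)⁻¹) (by positivity)
  refine (measure_mono fun w hw => ?_).trans_lt h
  rw [Set.mem_ofPred_eq, Real.norm_of_nonneg (by positivity)]
  have h2 : |w| ≤ R := hw
  have h3 : w ^ 2 ≤ R ^ 2 := by rw [← sq_abs]; gcongr
  gcongr

/-- The spectral measure is finite and has a finite second moment, and the spectral second moment
of an increment over a time `t` is controlled by `K 0 - K t`. -/
theorem exists_spectral_bounds {m β R M : ℝ} {K : ℝ → ℝ} (hm : 0 < m) (hβ : 0 < β) (hR : 0 < R)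
    (hν : IsSpectralMeasure ν) (hc : Continuous K)
    (hM : ∀ t, ‖K t‖ ≤ M) (hs : ∀ t, K (-t) = K t)
    (hle : ∀ t, K t ≤ K 0)
    (hE : ∀ φ : 𝓢(ℝ, ℝ),
      ∫⁻ w in {w : ℝ | R < |w|}, ENNReal.ofReal ((m / 2 * |w|) ^ 2 *
          ‖fourierS (complexify φ) w‖ ^ 2) ∂ν ≤
        ENNReal.ofReal (β * ∫ t, K t * conv φ (refl φ) t)) :
    IsFiniteMeasure ν ∧ Integrable (fun w : ℝ => w ^ 2) ν ∧
      ∃ C : ℝ, 0 ≤ C ∧ ∀ t : ℝ,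
        ∫ w, w ^ 2 * ‖1 - Complex.exp (-(Complex.I * t * w))‖ ^ 2 ∂ν ≤
          C * ((K 0 - K t) + t ^ 2) := by
  have hS : MeasurableSet {w : ℝ | R < |w|} := measurableSet_lt measurable_const (by fun_prop)
  have hcompl : {w : ℝ | R < |w|}ᶜ = {w : ℝ | |w| ≤ R} := by ext; simp
  have hlow : ν {w : ℝ | |w| ≤ R} < ⊤ := hν.measure_abs_le_lt_top R
  -- the mass at high frequencies, from the point mass at the origin
  have h1 : ∫⁻ w in {w : ℝ | R < |w|}, ENNReal.ofReal (w ^ 2) ∂ν < ⊤ := by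
    have h := lintegral_twoPoint_le hc hM hs hE 1 0 0
    have e : ∀ w : ℝ, ENNReal.ofReal ((m / 2 * |w|) ^ 2 *
        ‖((1 : ℝ) : ℂ) + (0 : ℝ) * Complex.exp (-(Complex.I * (0 : ℝ) * w))‖ ^ 2) =
        ENNReal.ofReal ((m / 2) ^ 2) * ENNReal.ofReal (w ^ 2) := by
      intro w
      rw [← ENNReal.ofReal_mul (by positivity), mul_pow, sq_abs]
      simp
    simp only [e] at h
    rw [lintegral_const_mul _ (by fun_prop)] at h
    have h2 := h.trans_lt ENNReal.ofReal_lt_top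
    rw [ENNReal.mul_lt_top_iff] at h2
    have hm2 : ENNReal.ofReal ((m / 2) ^ 2) ≠ 0 := by simp; positivity
    rcases h2 with h2 | h2 | h2
    · exact h2.2
    · exact absurd h2 hm2
    · rw [h2]; exact ENNReal.zero_lt_top
  have hhigh : ν {w : ℝ | R < |w|} < ⊤ := by
    have h2 : ENNReal.ofReal (R ^ 2) * ν {w : ℝ | R < |w|} ≤
        ∫⁻ w in {w : ℝ | R < |w|}, ENNReal.ofReal (w ^ 2) ∂ν := by
      rw [← setLIntegral_const]
      refine setLIntegral_mono (by fun_prop) fun w hw => ENNReal.ofReal_le_ofReal ?_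
      rw [← sq_abs w]
      have : R < |w| := hw
      gcongr
    have h3 := h2.trans_lt h1
    rw [ENNReal.mul_lt_top_iff] at h3
    rcases h3 with h3 | h3 | h3
    · exact h3.2
    · simp at h3; exact absurd h3 (by positivity)
    · rw [h3]; exact ENNReal.zero_lt_top
  have hfin : IsFiniteMeasure ν := by
    refine ⟨?_⟩
    rw [← measure_add_measure_compl hS, hcompl]
    exact ENNReal.add_lt_top.2 ⟨hhigh, hlow⟩
  have hint : Integrable (fun w : ℝ => w ^ 2) ν := by
    rw [← integrableOn_univ, ← Set.union_compl_self {w : ℝ | R < |w|}, hcompl]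
    refine IntegrableOn.union ⟨by fun_prop, ?_⟩ ?_
    · rw [hasFiniteIntegral_iff_ofReal (Eventually.of_forall fun w => sq_nonneg w)]
      exact h1
    · refine Measure.integrableOn_of_bounded (M := R ^ 2) hlow.ne (by fun_prop) ?_
      rw [← hcompl]
      refine (ae_restrict_iff' hS.compl).2 (Eventually.of_forall fun w hw => ?_)
      rw [hcompl] at hw
      rw [Real.norm_of_nonneg (sq_nonneg w), ← sq_abs w]
      have : |w| ≤ R := hw
      gcongr
  refine ⟨hfin, hint, max (8 * β / m ^ 2) (R ^ 4 * ν.real {w : ℝ | |w| ≤ R}), by positivity,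
    fun t => ?_⟩
  have hexp : ∀ w : ℝ, ‖1 - Complex.exp (-(Complex.I * t * w))‖ ≤ 2 := fun w => by
    refine (norm_sub_le _ _).trans ?_
    rw [norm_exp_neg_I_mul, norm_one]; norm_num
  have hmeas : Continuous fun w : ℝ => w ^ 2 * ‖1 - Complex.exp (-(Complex.I * t * w))‖ ^ 2 := by
    fun_prop
  have hint2 : Integrable (fun w : ℝ => w ^ 2 * ‖1 - Complex.exp (-(Complex.I * t * w))‖ ^ 2) ν :=
    (hint.mul_const 4).mono' hmeas.aestronglyMeasurable (Eventually.of_forall fun w => by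
      rw [Real.norm_of_nonneg (by positivity)]
      have := hexp w
      have h0 := norm_nonneg (1 - Complex.exp (-(Complex.I * t * w)))
      gcongr
      nlinarith)
  -- high frequencies, from the difference of two point masses
  have hA : ∫ w in {w : ℝ | R < |w|}, w ^ 2 * ‖1 - Complex.exp (-(Complex.I * t * w))‖ ^ 2 ∂ν ≤
      8 * β / m ^ 2 * (K 0 - K t) := by
    have h := lintegral_twoPoint_le hc hM hs hE 1 (-1) t
    have e : ∀ w : ℝ, (m / 2 * |w|) ^ 2 *
        ‖((1 : ℝ) : ℂ) + (-1 : ℝ) * Complex.exp (-(Complex.I * t * w))‖ ^ 2 =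
        m ^ 2 / 4 * (w ^ 2 * ‖1 - Complex.exp (-(Complex.I * t * w))‖ ^ 2) := by
      intro w
      rw [mul_pow, sq_abs, div_pow]
      push_cast
      rw [neg_one_mul, ← sub_eq_add_neg]
      ring
    simp only [e] at h
    have h2 : ∫ w in {w : ℝ | R < |w|},
        m ^ 2 / 4 * (w ^ 2 * ‖1 - Complex.exp (-(Complex.I * t * w))‖ ^ 2) ∂ν ≤
        β * ((1 ^ 2 + (-1) ^ 2) * K 0 + 2 * 1 * (-1) * K t) := by
      rw [integral_eq_lintegral_of_nonneg_ae (Eventually.of_forall fun w => by positivity)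
        (by fun_prop)]
      refine ENNReal.toReal_le_of_le_ofReal ?_ h
      have := hle t
      exact mul_nonneg hβ.le (by linarith)
    rw [integral_const_mul] at h2
    rw [div_mul_eq_mul_div, le_div_iff₀ (by positivity)]
    linarith
  -- low frequencies, from `|1 - exp(-i t w)| ≤ |t w|`
  have hB : ∫ w in {w : ℝ | |w| ≤ R}, w ^ 2 * ‖1 - Complex.exp (-(Complex.I * t * w))‖ ^ 2 ∂ν ≤
      R ^ 4 * ν.real {w : ℝ | |w| ≤ R} * t ^ 2 := by
    have h2 : ∀ w : ℝ, |w| ≤ R → w ^ 2 * ‖1 - Complex.exp (-(Complex.I * t * w))‖ ^ 2 ≤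
        R ^ 4 * t ^ 2 := by
      intro w hw
      have h3 : ‖1 - Complex.exp (-(Complex.I * t * w))‖ ≤ |t| * |w| := by
        have := Real.norm_exp_I_mul_ofReal_sub_one_le (x := -(t * w))
        rw [norm_neg, norm_mul, Real.norm_eq_abs, Real.norm_eq_abs] at this
        rw [norm_sub_rev]
        rwa [show Complex.I * ((-(t * w) : ℝ) : ℂ) = -(Complex.I * t * w) by push_cast; ring] at this
      calc w ^ 2 * ‖1 - Complex.exp (-(Complex.I * t * w))‖ ^ 2
          ≤ |w| ^ 2 * (|t| * |w|) ^ 2 := by rw [sq_abs]; gcongr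
        _ = |w| ^ 4 * |t| ^ 2 := by ring
        _ ≤ R ^ 4 * |t| ^ 2 := by gcongr
        _ = R ^ 4 * t ^ 2 := by rw [sq_abs]
    have h4 := setIntegral_mono_on (μ := ν) (s := {w : ℝ | |w| ≤ R}) hint2.integrableOn
      (integrableOn_const (C := R ^ 4 * t ^ 2) hlow.ne) (hcompl ▸ hS.compl) h2
    rw [setIntegral_const, smul_eq_mul] at h4
    linarith
  rw [← integral_add_compl hS hint2, hcompl, mul_add]
  refine (add_le_add hA hB).trans (add_le_add ?_ ?_)
  · exact mul_le_mul_of_nonneg_right (le_max_left _ _) (sub_nonneg.2 (hle t))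
  · exact mul_le_mul_of_nonneg_right (le_max_right _ _) (sq_nonneg t)

/-! ### Sub-Gaussian tails of stochastic integrals -/

theorem RandomMeasure.stepIntegral_ae_eq (ξ : RandomMeasure ν P) (c : FinSet ν →₀ ℂ) :
    ξ.stepIntegral c =ᵐ[P] fun x => ∑ E ∈ c.support, c E * ξ.toFun E x := by
  have h : ξ.stepIntegral c = ∑ E ∈ c.support, c E • ξ.toFun E := by
    rw [RandomMeasure.stepIntegral, Finsupp.linearCombination_apply, Finsupp.sum]
  rw [h]
  have h2 : ∀ᵐ x ∂P, ∀ E ∈ c.support, (c E • ξ.toFun E) x = c E * ξ.toFun E x := by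
    refine (c.support.eventually_all).2 fun E _ => ?_
    filter_upwards [Lp.coeFn_smul (c E) (ξ.toFun E)] with x hx
    rw [hx, Pi.smul_apply, smul_eq_mul]
  filter_upwards [Lp.coeFn_fun_finsetSum c.support fun E => c E • ξ.toFun E, h2] with x h3 h4
  rw [h3]
  exact Finset.sum_congr rfl h4

/-- Joint Gaussianity is over the reals; the real part of a complex combination of the values of
the random measure is a real linear functional of them. -/
theorem RandomMeasure.IsGaussian.hasGaussianLaw_re_stepIntegral {ξ : RandomMeasure ν P}
    (hξ : ξ.IsGaussian) (c : FinSet ν →₀ ℂ) :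
    HasGaussianLaw (fun x => (ξ.stepIntegral c x).re) P := by
  let L : (c.support → ℂ) →L[ℝ] ℝ := ∑ E : c.support, Complex.reCLM.comp
    (((ContinuousLinearMap.mul ℝ ℂ) (c E)).comp (ContinuousLinearMap.proj E))
  refine ((hξ.gaussian.hasGaussianLaw c.support).map_fun L).congr ?_
  filter_upwards [ξ.stepIntegral_ae_eq c] with x hx
  rw [hx, Complex.re_sum, ← Finset.sum_coe_sort]
  simp [L]

theorem RandomMeasure.IsGaussian.integral_stepIntegral [IsProbabilityMeasure P]
    {ξ : RandomMeasure ν P} (hξ : ξ.IsGaussian)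
    (c : FinSet ν →₀ ℂ) : ∫ x, ξ.stepIntegral c x ∂P = 0 := by
  rw [integral_congr_ae (ξ.stepIntegral_ae_eq c), integral_finsetSum]
  · refine Finset.sum_eq_zero fun E _ => ?_
    rw [integral_const_mul, hξ.centered E, mul_zero]
  · intro E _
    exact ((Lp.memLp (ξ.toFun E)).integrable one_le_two).const_mul _

theorem integral_re_sq_le [IsProbabilityMeasure P] (Z : Lp ℂ 2 P) :
    ∫ x, (Z x).re ^ 2 ∂P ≤ ‖Z‖ ^ 2 := by
  rw [norm_sq_eq_integral]
  have h2 : Integrable (fun x => ‖Z x‖ ^ 2) P := (Lp.memLp Z).integrable_norm_pow two_ne_zero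
  have hle : ∀ x, (Z x).re ^ 2 ≤ ‖Z x‖ ^ 2 := fun x => by
    rw [← sq_abs]
    have := Complex.abs_re_le_norm (Z x)
    gcongr
  refine integral_mono (h2.mono' ?_ (Eventually.of_forall fun x => ?_)) h2 hle
  · exact ((Complex.continuous_re.comp_aestronglyMeasurable (Lp.aestronglyMeasurable Z)).pow 2)
  · rw [Real.norm_of_nonneg (sq_nonneg _)]
    exact hle x

theorem RandomMeasure.IsGaussian.lintegral_exp_stepIntegral_le [IsProbabilityMeasure P]
    {ξ : RandomMeasure ν P} (hξ : ξ.IsGaussian) (c : FinSet ν →₀ ℂ) (s : ℝ) :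
    ∫⁻ x, ENNReal.ofReal (Real.exp (s * (ξ.stepIntegral c x).re)) ∂P ≤
      ENNReal.ofReal (Real.exp (‖stepL2 ν c‖ ^ 2 * s ^ 2 / 2)) := by
  have hG := hξ.hasGaussianLaw_re_stepIntegral c
  have hmean : ∫ x, (ξ.stepIntegral c x).re ∂P = 0 := by
    have h := hξ.integral_stepIntegral c
    have h2 := integral_re (𝕜 := ℂ) ((Lp.memLp (ξ.stepIntegral c)).integrable one_le_two)
    simp only [RCLike.re_to_complex] at h2
    rw [h2, h, Complex.zero_re]
  have hmgf := mgf_gaussianReal hG.map_eq_gaussianReal s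
  have hvar : Var[fun x => (ξ.stepIntegral c x).re; P] ≤ ‖stepL2 ν c‖ ^ 2 := by
    rw [← ξ.norm_stepIntegral]
    exact (variance_le_expectation_sq hG.aemeasurable.aestronglyMeasurable).trans
      (integral_re_sq_le _)
  have hint : Integrable (fun x => Real.exp (s * (ξ.stepIntegral c x).re)) P := by
    rw [← mgf_pos_iff, hmgf]
    positivity
  rw [← ofReal_integral_eq_lintegral_ofReal hint (Eventually.of_forall fun x => (Real.exp_pos _).le)]
  refine ENNReal.ofReal_le_ofReal ?_
  change mgf (fun x => (ξ.stepIntegral c x).re) P s ≤ _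
  rw [hmgf, hmean, Real.coe_toNNReal _ (variance_nonneg _ _)]
  gcongr
  rw [zero_mul, zero_add]
  gcongr

/-- Stochastic integrals are sub-Gaussian: the exponential moments of step functions pass to
`L²` limits by Fatou's lemma. -/
theorem RandomMeasure.IsGaussian.lintegral_exp_integral_le [IsProbabilityMeasure P]
    {ξ : RandomMeasure ν P} (hξ : ξ.IsGaussian) (u : Lp ℂ 2 ν) (s : ℝ) :
    ∫⁻ x, ENNReal.ofReal (Real.exp (s * (ξ.integral u x).re)) ∂P ≤
      ENNReal.ofReal (Real.exp (‖u‖ ^ 2 * s ^ 2 / 2)) := by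
  obtain ⟨a, ha, hau⟩ := mem_closure_iff_seq_limit.1 (denseRange_stepL2 ν u)
  choose c hc using ha
  have hlim : Tendsto (fun n => ξ.integral (a n)) atTop (𝓝 (ξ.integral u)) :=
    (ξ.integral.continuous.tendsto u).comp hau
  obtain ⟨ns, hns, hae⟩ := (tendstoInMeasure_of_tendsto_Lp hlim).exists_seq_tendsto_ae
  have hcont : Continuous fun z : ℂ => ENNReal.ofReal (Real.exp (s * z.re)) :=
    ENNReal.continuous_ofReal.comp (by fun_prop)
  calc _ = ∫⁻ x, liminf (fun n => ENNReal.ofReal (Real.exp (s * (ξ.integral (a (ns n)) x).re)))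
          atTop ∂P := by
        refine lintegral_congr_ae ?_
        filter_upwards [hae] with x hx
        exact (((hcont.tendsto _).comp hx).liminf_eq).symm
    _ ≤ liminf (fun n => ∫⁻ x, ENNReal.ofReal (Real.exp (s * (ξ.integral (a (ns n)) x).re)) ∂P)
          atTop := by
        refine lintegral_liminf_le' fun n => ?_
        exact hcont.measurable.comp_aemeasurable (Lp.aestronglyMeasurable _).aemeasurable
    _ ≤ liminf (fun n => ENNReal.ofReal (Real.exp (‖a (ns n)‖ ^ 2 * s ^ 2 / 2))) atTop := by
        refine liminf_le_liminf (Eventually.of_forall fun n => ?_)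
        rw [← hc (ns n), ξ.integral_stepL2]
        exact hξ.lintegral_exp_stepIntegral_le _ _
    _ = _ := by
        have h1 := (hau.comp hns.tendsto_atTop).norm
        have h2 : Continuous fun r : ℝ => ENNReal.ofReal (Real.exp (r ^ 2 * s ^ 2 / 2)) :=
          ENNReal.continuous_ofReal.comp (by fun_prop)
        exact ((h2.tendsto _).comp h1).liminf_eq

theorem RandomMeasure.IsGaussian.measure_le_re_integral [IsProbabilityMeasure P]
    {ξ : RandomMeasure ν P} (hξ : ξ.IsGaussian) (u : Lp ℂ 2 ν) {c v : ℝ} (hc : 0 ≤ c) (hv : 0 < v)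
    (huv : ‖u‖ ^ 2 ≤ v) :
    P {x | c ≤ (ξ.integral u x).re} ≤ ENNReal.ofReal (Real.exp (-(c ^ 2 / (2 * v)))) := by
  -- the minimizer of `v * s ^ 2 / 2 - s * c`
  set s := c / v with hs
  have hs0 : 0 ≤ s := by positivity
  have hcont : Continuous fun z : ℂ => ENNReal.ofReal (Real.exp (s * z.re)) :=
    ENNReal.continuous_ofReal.comp (by fun_prop)
  have hpos : ENNReal.ofReal (Real.exp (s * c)) ≠ 0 := by simp [Real.exp_pos]
  calc P {x | c ≤ (ξ.integral u x).re}
      ≤ P {x | ENNReal.ofReal (Real.exp (s * c)) ≤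
          ENNReal.ofReal (Real.exp (s * (ξ.integral u x).re))} := by
        refine measure_mono fun x hx => ?_
        have : c ≤ (ξ.integral u x).re := hx
        refine ENNReal.ofReal_le_ofReal ?_
        gcongr
    _ ≤ (∫⁻ x, ENNReal.ofReal (Real.exp (s * (ξ.integral u x).re)) ∂P) /
          ENNReal.ofReal (Real.exp (s * c)) :=
        meas_ge_le_lintegral_div
          (hcont.measurable.comp_aemeasurable (Lp.aestronglyMeasurable _).aemeasurable) hpos
          ENNReal.ofReal_ne_top
    _ ≤ ENNReal.ofReal (Real.exp (‖u‖ ^ 2 * s ^ 2 / 2)) / ENNReal.ofReal (Real.exp (s * c)) := by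
        gcongr
        exact hξ.lintegral_exp_integral_le u s
    _ ≤ _ := by
        rw [← ENNReal.ofReal_div_of_pos (Real.exp_pos _), ← Real.exp_sub]
        refine ENNReal.ofReal_le_ofReal (Real.exp_le_exp.2 ?_)
        have h1 : ‖u‖ ^ 2 * s ^ 2 / 2 ≤ v * s ^ 2 / 2 := by gcongr
        have h2 : v * s ^ 2 / 2 - s * c = -(c ^ 2 / (2 * v)) := by
          rw [hs]; field_simp; ring
        linarith

/-- The Gaussian tail bound for stochastic integrals. -/
theorem RandomMeasure.IsGaussian.measure_le_norm_integral [IsProbabilityMeasure P]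
    {ξ : RandomMeasure ν P} (hξ : ξ.IsGaussian) (u : Lp ℂ 2 ν) {c v : ℝ} (hc : 0 ≤ c) (hv : 0 < v)
    (huv : ‖u‖ ^ 2 ≤ v) :
    P {x | c ≤ ‖ξ.integral u x‖} ≤ ENNReal.ofReal (4 * Real.exp (-(c ^ 2 / (8 * v)))) := by
  have key : ∀ ζ : ℂ, ‖ζ‖ = 1 → P {x | c / 2 ≤ (ζ * ξ.integral u x).re} ≤
      ENNReal.ofReal (Real.exp (-(c ^ 2 / (8 * v)))) := by
    intro ζ hζ
    have h := hξ.measure_le_re_integral (ζ • u) (c := c / 2) (v := v) (by positivity) hv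
      (by rwa [norm_smul, hζ, one_mul])
    rw [show (c / 2) ^ 2 / (2 * v) = c ^ 2 / (8 * v) by field_simp; ring] at h
    refine le_trans (measure_mono_ae ?_) h
    filter_upwards [Lp.coeFn_smul ζ (ξ.integral u)] with x hx h2
    change c / 2 ≤ (ξ.integral (ζ • u) x).re
    rw [map_smul, hx, Pi.smul_apply, smul_eq_mul]
    exact h2
  have hsub : {x | c ≤ ‖ξ.integral u x‖} ⊆
      (({x | c / 2 ≤ ((1 : ℂ) * ξ.integral u x).re} ∪
        {x | c / 2 ≤ ((-1 : ℂ) * ξ.integral u x).re}) ∪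
      ({x | c / 2 ≤ (Complex.I * ξ.integral u x).re} ∪
        {x | c / 2 ≤ (-Complex.I * ξ.integral u x).re})) := by
    intro x hx
    have h1 : c ≤ |(ξ.integral u x).re| + |(ξ.integral u x).im| :=
      le_trans hx (Complex.norm_le_abs_re_add_abs_im _)
    simp only [Set.mem_union, Set.mem_ofPred_eq, Complex.mul_re, Complex.one_re, Complex.one_im,
      Complex.neg_re, Complex.neg_im, Complex.I_re, Complex.I_im]
    by_contra hcon
    push Not at hcon
    obtain ⟨⟨a1, a2⟩, a3, a4⟩ := hcon
    have b1 : |(ξ.integral u x).re| < c / 2 := abs_lt.2 ⟨by linarith, by linarith⟩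
    have b2 : |(ξ.integral u x).im| < c / 2 := abs_lt.2 ⟨by linarith, by linarith⟩
    linarith
  refine (measure_mono hsub).trans ((measure_union_le _ _).trans ((add_le_add
    (measure_union_le _ _) (measure_union_le _ _)).trans ?_))
  refine (add_le_add (add_le_add (key 1 (by simp)) (key (-1) (by simp)))
    (add_le_add (key Complex.I (by simp)) (key (-Complex.I) (by simp)))).trans ?_
  have hp := (Real.exp_pos (-(c ^ 2 / (8 * v)))).le
  rw [← ENNReal.ofReal_add hp hp, ← ENNReal.ofReal_add (by positivity) (by positivity)]
  refine ENNReal.ofReal_le_ofReal ?_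
  linarith

/-! ### Dyadic chaining -/

/-- The largest dyadic rational of level `n` that is at most `t`. -/
def dyadicFloor (n : ℕ) (t : ℝ) : ℝ := (⌊t * 2 ^ n⌋ : ℝ) / 2 ^ n

theorem abs_sub_dyadicFloor_le (n : ℕ) (t : ℝ) : |t - dyadicFloor n t| ≤ (1 / 2) ^ n := by
  have h2 : (0 : ℝ) < 2 ^ n := by positivity
  have h3 : t - dyadicFloor n t = (t * 2 ^ n - ⌊t * 2 ^ n⌋) / 2 ^ n := by
    rw [dyadicFloor]; field_simp
  have h4 := Int.floor_le (t * 2 ^ n)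
  have h5 := Int.lt_floor_add_one (t * 2 ^ n)
  rw [h3, abs_div, abs_of_pos h2, abs_of_nonneg (by linarith), one_div, inv_pow, div_eq_mul_inv]
  exact mul_le_of_le_one_left (by positivity) (by linarith)

theorem abs_floor_le {n N : ℕ} (hn : N + 1 ≤ n) {t : ℝ} (ht : |t| ≤ N) :
    |⌊t * 2 ^ n⌋| ≤ (n : ℤ) * 2 ^ n := by
  have h1 : (1 : ℝ) ≤ 2 ^ n := one_le_pow₀ one_le_two
  have h4 := Int.floor_le (t * 2 ^ n)
  have h5 := Int.lt_floor_add_one (t * 2 ^ n)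
  have hn' : (N : ℝ) + 1 ≤ n := by exact_mod_cast hn
  obtain ⟨h6, h7⟩ := abs_le.1 ht
  have h8 : |(⌊t * 2 ^ n⌋ : ℝ)| ≤ (n : ℝ) * 2 ^ n := by
    rw [abs_le]
    constructor <;> nlinarith
  exact_mod_cast h8

/-- If the increments of `y` over neighbouring dyadic rationals of level `n` are bounded by the
terms of a convergent series, then `y` has a continuous extension from the dyadic rationals. -/
theorem exists_continuous_of_dyadic_increments {y : ℝ → ℂ} {c : ℕ → ℝ} (hc : Summable c)
    (hc0 : ∀ n, 0 ≤ c n) {n₀ : ℕ}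
    (h : ∀ n, n₀ ≤ n → ∀ j : ℤ, |j| ≤ (n : ℤ) * 2 ^ n →
      ‖y (((j + 1 : ℤ) : ℝ) / 2 ^ n) - y ((j : ℝ) / 2 ^ n)‖ ≤ c n) :
    ∃ z : ℝ → ℂ, Continuous z ∧ ∀ t, Tendsto (fun n => y (dyadicFloor n t)) atTop (𝓝 (z t)) := by
  have hstep : ∀ (N n : ℕ) (t : ℝ), |t| ≤ N → n₀ ≤ n → N + 1 ≤ n →
      dist (y (dyadicFloor n t)) (y (dyadicFloor (n + 1) t)) ≤ c (n + 1) := by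
    intro N n t ht hn hN
    have hf1 := Int.floor_le (t * 2 ^ n)
    have hf2 := Int.lt_floor_add_one (t * 2 ^ n)
    set j := ⌊t * 2 ^ n⌋ with hj
    have hjn : |j| ≤ (n : ℤ) * 2 ^ n := abs_floor_le hN ht
    have hpt : dyadicFloor n t = ((2 * j : ℤ) : ℝ) / 2 ^ (n + 1) := by
      rw [dyadicFloor, ← hj, pow_succ]; push_cast; field_simp
    have hcases : ⌊t * 2 ^ (n + 1)⌋ = 2 * j ∨ ⌊t * 2 ^ (n + 1)⌋ = 2 * j + 1 := by
      have e1 : 2 * j ≤ ⌊t * 2 ^ (n + 1)⌋ := by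
        rw [Int.le_floor, pow_succ]; push_cast; linarith
      have e2 : ⌊t * 2 ^ (n + 1)⌋ < 2 * j + 2 := by
        rw [Int.floor_lt, pow_succ]; push_cast; linarith
      omega
    rcases hcases with e | e
    · rw [hpt, dyadicFloor, e, dist_self]; exact hc0 _
    · rw [hpt, dyadicFloor, e, dist_comm, dist_eq_norm]
      refine h (n + 1) (by omega) (2 * j) ?_
      rw [abs_mul, pow_succ]
      push_cast
      have : (0 : ℤ) < 2 ^ n := by positivity
      rw [abs_of_pos (by norm_num : (0 : ℤ) < 2)]
      nlinarith
  -- uniform convergence on bounded intervals, at the rate given by the tails of `∑ c n`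
  have hconv : ∀ t, ∃ z, Tendsto (fun n => y (dyadicFloor n t)) atTop (𝓝 z) := by
    intro t
    obtain ⟨N, hN⟩ := exists_nat_ge |t|
    have hcs : CauchySeq fun n => y (dyadicFloor (n + (n₀ + N + 1)) t) := by
      refine cauchySeq_of_dist_le_of_summable (fun n => c (n + (n₀ + N + 1) + 1)) (fun n => ?_)
        ((summable_nat_add_iff (n₀ + N + 2)).2 hc)
      have := hstep N (n + (n₀ + N + 1)) t hN (by omega) (by omega)
      rwa [show n.succ + (n₀ + N + 1) = n + (n₀ + N + 1) + 1 by omega]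
    obtain ⟨z, hz⟩ := cauchySeq_tendsto_of_complete hcs
    exact ⟨z, (tendsto_add_atTop_iff_nat (f := fun n => y (dyadicFloor n t)) _).1 hz⟩
  choose z hz using hconv
  refine ⟨z, ?_, hz⟩
  have htail : ∀ (N n : ℕ) (t : ℝ), |t| ≤ N →
      dist (y (dyadicFloor (n + (n₀ + N + 1)) t)) (z t) ≤ ∑' k, c (k + (n + (n₀ + N + 2))) := by
    intro N n t ht
    have := dist_le_tsum_of_dist_le_of_tendsto
      (f := fun n => y (dyadicFloor (n + (n₀ + N + 1)) t)) (fun n => c (n + (n₀ + N + 1) + 1))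
      (fun n => by
        have := hstep N (n + (n₀ + N + 1)) t ht (by omega) (by omega)
        rwa [show n.succ + (n₀ + N + 1) = n + (n₀ + N + 1) + 1 by omega])
      ((summable_nat_add_iff (n₀ + N + 2)).2 hc)
      ((tendsto_add_atTop_iff_nat (f := fun n => y (dyadicFloor n t)) _).2 (hz t)) n
    refine this.trans (le_of_eq (tsum_congr fun k => ?_))
    congr 1; omega
  rw [Metric.continuous_iff]
  intro t₀ ε hε
  obtain ⟨N, hN⟩ := exists_nat_ge (|t₀| + 1)
  have hT := (tendsto_sum_nat_add c).comp (tendsto_add_atTop_nat (n₀ + N + 2))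
  have hC := hc.tendsto_atTop_zero.comp (tendsto_add_atTop_nat (n₀ + N + 1))
  have hε3 : 0 < ε / 3 := by linarith
  obtain ⟨n, hn1, hn2⟩ := ((hT.eventually (gt_mem_nhds hε3)).and
    (hC.eventually (gt_mem_nhds hε3))).exists
  simp only [Function.comp] at hn1 hn2
  set n' := n + (n₀ + N + 1) with hn'
  have hp : (0 : ℝ) < 2 ^ n' := by positivity
  have key : ∀ s t : ℝ, |s| ≤ N → s ≤ t → t - s < (1 / 2) ^ n' →
      dist (y (dyadicFloor n' s)) (y (dyadicFloor n' t)) ≤ c n' := by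
    intro s t hs hst hts
    have hf1 := Int.floor_le (s * 2 ^ n')
    have hf2 := Int.lt_floor_add_one (s * 2 ^ n')
    have h3 : (t - s) * 2 ^ n' < 1 := by
      rwa [one_div, inv_pow, ← one_div, lt_div_iff₀ hp] at hts
    have hcases : ⌊t * 2 ^ n'⌋ = ⌊s * 2 ^ n'⌋ ∨ ⌊t * 2 ^ n'⌋ = ⌊s * 2 ^ n'⌋ + 1 := by
      have e1 : ⌊s * 2 ^ n'⌋ ≤ ⌊t * 2 ^ n'⌋ := Int.floor_le_floor (by gcongr)
      have e2 : ⌊t * 2 ^ n'⌋ < ⌊s * 2 ^ n'⌋ + 2 := by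
        rw [Int.floor_lt]; push_cast; linarith
      omega
    rcases hcases with e | e
    · rw [dyadicFloor, dyadicFloor, e, dist_self]; exact hc0 _
    · rw [dyadicFloor, dyadicFloor, e, dist_comm, dist_eq_norm]
      exact h n' (by omega) _ (abs_floor_le (by omega) hs)
  refine ⟨min 1 ((1 / 2) ^ n'), by positivity, fun t ht => ?_⟩
  rw [Real.dist_eq, lt_min_iff] at ht
  have ht1 : |t| ≤ N := by
    have := abs_sub_abs_le_abs_sub t t₀
    linarith
  have ht2 : |t₀| ≤ N := by linarith
  have hmid : dist (y (dyadicFloor n' t)) (y (dyadicFloor n' t₀)) ≤ c n' := by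
    rcases le_total t t₀ with hle | hle
    · exact key t t₀ ht1 hle (by rw [abs_sub_comm, abs_of_nonneg (by linarith)] at ht; exact ht.2)
    · rw [dist_comm]
      exact key t₀ t ht2 hle (by rw [abs_of_nonneg (by linarith)] at ht; exact ht.2)
  have ha := htail N n t ht1
  have hb := htail N n t₀ ht2
  rw [dist_comm] at ha
  calc dist (z t) (z t₀) ≤ dist (z t) (y (dyadicFloor n' t)) +
        dist (y (dyadicFloor n' t)) (y (dyadicFloor n' t₀)) +
        dist (y (dyadicFloor n' t₀)) (z t₀) := dist_triangle4 _ _ _ _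
    _ < ε := by linarith

/-- The factor `2 (n 2ⁿ) + 1` counts the increments of level `n`, and the exponential bounds the
probability that one of them is large; for `p > 1` it beats the growth of the count. -/
theorem summable_dyadic_tail {κ p : ℝ} (hκ : 0 < κ) (hp : 1 < p) :
    Summable fun n : ℕ => (2 * ((n : ℝ) * 2 ^ n) + 1) *
      (4 * Real.exp (-(κ * (n : ℝ) ^ p))) := by
  have hlim : Tendsto (fun n : ℕ => κ * (n : ℝ) ^ (p - 1)) atTop atTop :=
    ((tendsto_rpow_atTop (by linarith)).comp tendsto_natCast_atTop_atTop).const_mul_atTop hκ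
  refine Summable.of_norm_bounded_eventually_nat (g := fun n : ℕ => 12 * Real.exp (-1) ^ n)
    ((summable_geometric_of_lt_one (Real.exp_pos _).le (by simp)).mul_left 12) ?_
  filter_upwards [hlim.eventually_ge_atTop 3, eventually_gt_atTop 0] with n hn hn0
  have hn1 : (0 : ℝ) < n := by exact_mod_cast hn0
  have h1 : 3 * (n : ℝ) ≤ κ * (n : ℝ) ^ p := by
    have : (n : ℝ) ^ p = (n : ℝ) ^ (p - 1) * n := by
      conv_rhs => rw [← Real.rpow_add_one hn1.ne']
      rw [sub_add_cancel]
    rw [this, ← mul_assoc]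
    gcongr
  have h2 : (n : ℝ) ≤ Real.exp n := by linarith [Real.add_one_le_exp (n : ℝ)]
  have h3 : (2 : ℝ) ^ n ≤ Real.exp n := by
    have : (2 : ℝ) ≤ Real.exp 1 := by linarith [Real.add_one_le_exp (1 : ℝ)]
    calc (2 : ℝ) ^ n ≤ Real.exp 1 ^ n := by gcongr
      _ = Real.exp n := by rw [← Real.exp_nat_mul, mul_one]
  have h4 : (1 : ℝ) ≤ Real.exp n := Real.one_le_exp hn1.le
  have h5 : Real.exp (-(κ * (n : ℝ) ^ p)) ≤ Real.exp (-(3 * (n : ℝ))) :=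
    Real.exp_le_exp.2 (by linarith)
  rw [Real.norm_of_nonneg (by positivity)]
  calc (2 * ((n : ℝ) * 2 ^ n) + 1) * (4 * Real.exp (-(κ * (n : ℝ) ^ p)))
      ≤ (2 * (Real.exp n * Real.exp n) + Real.exp n * Real.exp n) *
          (4 * Real.exp (-(3 * (n : ℝ)))) := by
        gcongr
        nlinarith
    _ = 12 * (Real.exp n * Real.exp n * Real.exp (-(3 * (n : ℝ)))) := by ring
    _ = 12 * Real.exp (-1) ^ n := by
        rw [← Real.exp_add, ← Real.exp_add, ← Real.exp_nat_mul]
        congr 2; ring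

/-- A Gaussian process whose increments over distances at most `2⁻ⁿ` have variance `O(n⁻ᵇ)`, with
`b > 3`, has a continuous version: the maximum of the `O(n 2ⁿ)` increments at level `n` over a
bounded interval is eventually at most `n⁻ᵃ` for any `a < (b - 1) / 2`, and `a > 1` makes these
bounds summable. -/
theorem RandomMeasure.IsGaussian.exists_continuous_version [IsProbabilityMeasure P]
    {ξ : RandomMeasure ν P} (hξ : ξ.IsGaussian) (u : ℝ → Lp ℂ 2 ν) {C b : ℝ} (hC : 0 < C)
    (hb : 3 < b)
    (hu : ∀ᶠ n : ℕ in atTop, ∀ s t : ℝ, |t - s| ≤ (1 / 2) ^ n →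
      ‖u t - u s‖ ^ 2 ≤ C * (n : ℝ) ^ (-b)) :
    ∃ Z : ℝ → Ω → ℂ, (∀ᵐ x ∂P, Continuous fun t => Z t x) ∧
      ∀ t, Z t =ᵐ[P] ξ.integral (u t) := by
  -- the midpoint of the interval `(1, (b - 1) / 2)`, so that `1 < a` and `1 < b - 2 * a`
  set a : ℝ := (b + 1) / 4 with ha
  set Y : ℝ → Lp ℂ 2 P := fun t => ξ.integral (u t) with hY
  -- the event that some increment of level `n` in `[-n, n]` is large
  set B : ℕ → Set Ω := fun n => ⋃ j ∈ Finset.Icc (-((n : ℤ) * 2 ^ n)) ((n : ℤ) * 2 ^ n),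
    {x | (n : ℝ) ^ (-a) ≤ ‖Y (((j + 1 : ℤ) : ℝ) / 2 ^ n) x - Y ((j : ℝ) / 2 ^ n) x‖} with hB
  have hBn : ∀ᶠ n : ℕ in atTop, P (B n) ≤ ENNReal.ofReal ((2 * ((n : ℝ) * 2 ^ n) + 1) *
      (4 * Real.exp (-(1 / (8 * C) * (n : ℝ) ^ ((b - 1) / 2))))) := by
    filter_upwards [hu, eventually_gt_atTop 0] with n hn hn0
    have hn1 : (0 : ℝ) < n := by exact_mod_cast hn0
    have hj : ∀ j : ℤ, P {x | (n : ℝ) ^ (-a) ≤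
        ‖Y (((j + 1 : ℤ) : ℝ) / 2 ^ n) x - Y ((j : ℝ) / 2 ^ n) x‖} ≤
        ENNReal.ofReal (4 * Real.exp (-(1 / (8 * C) * (n : ℝ) ^ ((b - 1) / 2)))) := by
      intro j
      have h1 := hn ((j : ℝ) / 2 ^ n) (((j + 1 : ℤ) : ℝ) / 2 ^ n) (by
        rw [← sub_div]; push_cast
        rw [add_sub_cancel_left, one_div, one_div, inv_pow, abs_of_pos (by positivity)])
      have h2 := hξ.measure_le_norm_integral _ (c := (n : ℝ) ^ (-a)) (by positivity)
        (by positivity) h1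
      have h3 : ((n : ℝ) ^ (-a)) ^ 2 / (8 * (C * (n : ℝ) ^ (-b))) =
          1 / (8 * C) * (n : ℝ) ^ ((b - 1) / 2) := by
        have e1 : ((n : ℝ) ^ (-a)) ^ 2 = (n : ℝ) ^ ((b - 1) / 2) * (n : ℝ) ^ (-b) := by
          rw [← Real.rpow_natCast, ← Real.rpow_mul hn1.le, ← Real.rpow_add hn1]
          congr 1; rw [ha]; push_cast; ring
        have e2 : (n : ℝ) ^ (-b) ≠ 0 := (Real.rpow_pos_of_pos hn1 _).ne'
        rw [e1]; field_simp
      rw [h3] at h2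
      refine le_trans (measure_mono_ae ?_) h2
      filter_upwards [Lp.coeFn_sub (Y (((j + 1 : ℤ) : ℝ) / 2 ^ n)) (Y ((j : ℝ) / 2 ^ n))] with x hx h4
      change (n : ℝ) ^ (-a) ≤ _
      rw [map_sub, hx, Pi.sub_apply]
      exact h4
    refine (measure_biUnion_finset_le _ _).trans ((Finset.sum_le_sum fun j _ => hj j).trans ?_)
    rw [Finset.sum_const, nsmul_eq_mul, Int.card_Icc,
      ENNReal.ofReal_mul (p := 2 * ((n : ℝ) * 2 ^ n) + 1) (by positivity)]
    gcongr
    rw [← ENNReal.ofReal_natCast]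
    refine ENNReal.ofReal_le_ofReal ?_
    have h0 : (0 : ℤ) ≤ (n : ℤ) * 2 ^ n := by positivity
    have : (((n : ℤ) * 2 ^ n + 1 - -((n : ℤ) * 2 ^ n)).toNat : ℤ) =
        2 * ((n : ℤ) * 2 ^ n) + 1 := by
      rw [Int.toNat_of_nonneg (by linarith)]; ring
    exact_mod_cast this.le
  have hsum : ∑' n, P (B n) ≠ ⊤ := by
    obtain ⟨n₁, hn₁⟩ := eventually_atTop.1 hBn
    have hS := (summable_nat_add_iff n₁).2
      (summable_dyadic_tail (κ := 1 / (8 * C)) (p := (b - 1) / 2) (by positivity) (by linarith))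
    have h1 : ∑' n, P (B (n + n₁)) ≠ ⊤ := by
      refine ne_top_of_le_ne_top ?_ (ENNReal.tsum_le_tsum fun n => hn₁ (n + n₁) (by omega))
      rw [← ENNReal.ofReal_tsum_of_nonneg (fun n => by positivity) hS]
      exact ENNReal.ofReal_ne_top
    rw [← ENNReal.summable.sum_add_tsum_nat_add' (f := fun n => P (B n)) (k := n₁)]
    exact ENNReal.add_ne_top.2 ⟨(ENNReal.sum_lt_top.2 fun n _ => measure_lt_top P _).ne, h1⟩
  have hpath : ∀ᵐ x ∂P, ∃ z : ℝ → ℂ, Continuous z ∧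
      ∀ t, Tendsto (fun n => Y (dyadicFloor n t) x) atTop (𝓝 (z t)) := by
    filter_upwards [ae_eventually_notMem hsum] with x hx
    obtain ⟨n₀, hn₀⟩ := eventually_atTop.1 hx
    refine exists_continuous_of_dyadic_increments (y := fun t => Y t x)
      (c := fun n : ℕ => (n : ℝ) ^ (-a)) (n₀ := n₀)
      (Real.summable_nat_rpow.2 (by rw [ha]; linarith)) (fun n => by positivity)
      (fun n hn j hj => ?_)
    have h1 := hn₀ n hn
    simp only [hB, Set.mem_iUnion, not_exists] at h1
    have h2 := h1 j (Finset.mem_Icc.2 (abs_le.1 hj))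
    exact (not_le.1 h2).le
  refine ⟨fun t x => limUnder atTop fun n => Y (dyadicFloor n t) x, ?_, fun t => ?_⟩
  · filter_upwards [hpath] with x ⟨z, hz, hlim⟩
    convert hz using 2 with t
    exact (hlim t).limUnder_eq
  · have hYlim : Tendsto (fun n => Y (dyadicFloor n t)) atTop (𝓝 (Y t)) := by
      rw [tendsto_iff_norm_sub_tendsto_zero]
      have h1 : Tendsto (fun n : ℕ => Real.sqrt (C * (n : ℝ) ^ (-b))) atTop (𝓝 0) := by
        have := ((tendsto_rpow_neg_atTop (by linarith : 0 < b)).comp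
          tendsto_natCast_atTop_atTop).const_mul C
        rw [mul_zero] at this
        have h := (Real.continuous_sqrt.tendsto 0).comp this
        rwa [Real.sqrt_zero] at h
      refine squeeze_zero' (Eventually.of_forall fun n => norm_nonneg _) ?_ h1
      filter_upwards [hu] with n hn
      refine Real.le_sqrt_of_sq_le ?_
      rw [hY, ← map_sub, ξ.norm_integral]
      refine hn _ _ ?_
      rw [abs_sub_comm]
      exact abs_sub_dyadicFloor_le n t
    obtain ⟨ns, hns, hae⟩ := (tendstoInMeasure_of_tendsto_Lp hYlim).exists_seq_tendsto_ae
    filter_upwards [hpath, hae] with x ⟨z, hz, hlim⟩ hx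
    rw [(hlim t).limUnder_eq]
    exact tendsto_nhds_unique ((hlim t).comp hns.tendsto_atTop) hx

/-! ### Riemann sums -/

theorem tendsto_riemannSum {f : ℝ → ℂ} (hf : Continuous f) (t : ℝ) :
    Tendsto (fun n : ℕ => ∑ k ∈ Finset.range n, ((t / n : ℝ) : ℂ) * f (k * (t / n))) atTop
      (𝓝 (∫ s in (0 : ℝ)..t, f s)) := by
  rw [Metric.tendsto_atTop]
  intro ε hε
  have huc := (isCompact_closedBall (0 : ℝ) |t|).uniformContinuousOn_of_continuous hf.continuousOn
  rw [Metric.uniformContinuousOn_iff] at huc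
  have hε2 : 0 < ε / (|t| + 1) := by positivity
  obtain ⟨δ, hδ, hδf⟩ := huc _ hε2
  obtain ⟨n₀, hn₀⟩ := exists_nat_gt (|t| / δ)
  refine ⟨max n₀ 1, fun n hn => ?_⟩
  have hn1 : 1 ≤ n := (le_max_right _ _).trans hn
  have hnpos : (0 : ℝ) < n := by exact_mod_cast hn1
  have hnδ : |t| / n < δ := by
    have h1 : (n₀ : ℝ) ≤ n := by exact_mod_cast (le_max_left _ _).trans hn
    rw [div_lt_iff₀ hδ] at hn₀
    rw [div_lt_iff₀ hnpos]
    nlinarith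
  have hi : ∀ a b, IntervalIntegrable f volume a b := fun a b => hf.intervalIntegrable a b
  have hsum := intervalIntegral.sum_integral_adjacent_intervals (f := f) (μ := volume)
    (a := fun k : ℕ => (k : ℝ) * (t / n)) (n := n) fun k _ => hi _ _
  rw [Nat.cast_zero, zero_mul, mul_div_cancel₀ _ hnpos.ne'] at hsum
  rw [← hsum, dist_eq_norm, ← Finset.sum_sub_distrib]
  have hterm : ∀ k ∈ Finset.range n, ‖((t / n : ℝ) : ℂ) * f (k * (t / n)) -
      ∫ s in ((k : ℕ) : ℝ) * (t / n)..((k + 1 : ℕ) : ℝ) * (t / n), f s‖ ≤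
      ε / (|t| + 1) * (|t| / n) := by
    intro k hk
    have hkn : (k : ℝ) + 1 ≤ n := by exact_mod_cast Finset.mem_range.1 hk
    have hlen : ((k + 1 : ℕ) : ℝ) * (t / n) - (k : ℝ) * (t / n) = t / n := by push_cast; ring
    have hconst : ((t / n : ℝ) : ℂ) * f (k * (t / n)) =
        ∫ s in ((k : ℕ) : ℝ) * (t / n)..((k + 1 : ℕ) : ℝ) * (t / n), f (k * (t / n)) := by
      rw [intervalIntegral.integral_const, hlen, Complex.real_smul]
    rw [hconst, ← intervalIntegral.integral_sub (by simp) (hi _ _)]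
    have habs : |t / n| = |t| / n := by rw [abs_div, abs_of_pos hnpos]
    have hball : ∀ r : ℝ, 0 ≤ r → r ≤ n → r * (t / n) ∈ Metric.closedBall (0 : ℝ) |t| := by
      intro r hr0 hr
      rw [mem_closedBall_zero_iff, Real.norm_eq_abs, abs_mul, habs, abs_of_nonneg hr0,
        ← mul_div_assoc, div_le_iff₀ hnpos, mul_comm]
      gcongr
    refine (intervalIntegral.norm_integral_le_of_norm_le_const (C := ε / (|t| + 1))
      fun s hs => ?_).trans ?_
    · have hs' := Set.uIoc_subset_uIcc hs
      have hk0 : (0 : ℝ) ≤ k := k.cast_nonneg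
      have hsb : s ∈ Metric.closedBall (0 : ℝ) |t| := by
        have h1 := hball k hk0 (by linarith)
        have h2 := hball ((k + 1 : ℕ) : ℝ) (by positivity) (by push_cast; exact hkn)
        exact ((convex_closedBall (0 : ℝ) |t|).ordConnected.uIcc_subset h1 h2) hs'
      have hdist : dist ((k : ℝ) * (t / n)) s < δ := by
        have h3 := Set.abs_sub_left_of_mem_uIcc hs'
        rw [hlen, habs] at h3
        rw [dist_comm, Real.dist_eq]
        exact h3.trans_lt hnδ
      have := hδf _ (hball k hk0 (by linarith)) _ hsb hdist
      rw [dist_eq_norm] at this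
      exact this.le
    · rw [hlen, habs]
  refine (norm_sum_le_of_le _ hterm).trans_lt ?_
  rw [Finset.sum_const, Finset.card_range, nsmul_eq_mul]
  have e : (n : ℝ) * (ε / (|t| + 1) * (|t| / n)) = ε * (|t| / (|t| + 1)) := by
    field_simp
  rw [e]
  have : |t| / (|t| + 1) < 1 := by rw [div_lt_one (by positivity)]; linarith
  nlinarith

/-- Dominated convergence in `L²`. -/
theorem tendsto_Lp_two_of_dominated {f : ℕ → Lp ℂ 2 ν} {g : Lp ℂ 2 ν} {B : ℝ → ℝ}
    (hB : Integrable (fun w => B w ^ 2) ν) (hb : ∀ n, ∀ᵐ w ∂ν, ‖f n w - g w‖ ≤ B w)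
    (hlim : ∀ᵐ w ∂ν, Tendsto (fun n => f n w) atTop (𝓝 (g w))) : Tendsto f atTop (𝓝 g) := by
  rw [tendsto_iff_norm_sub_tendsto_zero]
  have h1 : Tendsto (fun n => ‖f n - g‖ ^ 2) atTop (𝓝 0) := by
    simp only [norm_sq_eq_integral]
    have h2 : ∀ n, ∫ w, ‖(f n - g) w‖ ^ 2 ∂ν = ∫ w, ‖f n w - g w‖ ^ 2 ∂ν := fun n => by
      refine integral_congr_ae ?_
      filter_upwards [Lp.coeFn_sub (f n) g] with w hw
      rw [hw, Pi.sub_apply]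
    simp only [h2]
    rw [show (0 : ℝ) = ∫ w, (0 : ℝ) ∂ν by simp]
    refine tendsto_integral_of_dominated_convergence (fun w => B w ^ 2) (fun n => ?_) hB
      (fun n => ?_) ?_
    · exact (((Lp.aestronglyMeasurable (f n)).sub (Lp.aestronglyMeasurable g)).norm.pow 2)
    · filter_upwards [hb n] with w hw
      rw [Real.norm_of_nonneg (by positivity)]
      gcongr
    · filter_upwards [hlim] with w hw
      have := ((hw.sub_const (g w)).norm).pow 2
      simpa using this
  have h3 := (Real.continuous_sqrt.tendsto 0).comp h1
  simpa [Function.comp_def, Real.sqrt_sq (norm_nonneg _)] using h3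

/-! ### The curves `t ↦ exp(i t ω)` and `t ↦ i ω exp(i t ω)` in `L²(ν)` -/

/-- The function `ω ↦ exp(i t ω)`, in the form in which it enters the stochastic integral. -/
def wave (t : ℝ) : ℝ → ℂ := star fun w : ℝ => Complex.exp (-(Complex.I * t * w))

/-- The time derivative `ω ↦ i ω exp(i t ω)` of the waves. -/
def waveDeriv (t w : ℝ) : ℂ := Complex.I * w * wave t w

theorem wave_apply (t w : ℝ) : wave t w = Complex.exp (Complex.I * w * t) := by
  change conj (Complex.exp (-(Complex.I * t * w))) = _
  rw [← Complex.exp_conj]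
  simp only [map_neg, map_mul, Complex.conj_I, Complex.conj_ofReal]
  congr 1; ring

theorem norm_wave (t w : ℝ) : ‖wave t w‖ = 1 := by
  change ‖conj (Complex.exp (-(Complex.I * t * w)))‖ = 1
  rw [RCLike.norm_conj, norm_exp_neg_I_mul]

theorem norm_waveDeriv (t w : ℝ) : ‖waveDeriv t w‖ = |w| := by
  rw [waveDeriv, norm_mul, norm_mul, norm_wave, Complex.norm_I, Complex.norm_real,
    Real.norm_eq_abs, one_mul, mul_one]

theorem continuous_wave (t : ℝ) : Continuous (wave t) := by
  rw [show wave t = fun w : ℝ => Complex.exp (Complex.I * w * t) from funext (wave_apply t)]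
  fun_prop

theorem continuous_waveDeriv (t : ℝ) : Continuous (waveDeriv t) := by
  have := continuous_wave t
  unfold waveDeriv
  fun_prop

theorem continuous_waveDeriv_left (w : ℝ) : Continuous fun t => waveDeriv t w := by
  simp only [waveDeriv, wave_apply]
  fun_prop

theorem integral_waveDeriv (t w : ℝ) :
    ∫ s in (0 : ℝ)..t, waveDeriv s w = wave t w - wave 0 w := by
  refine intervalIntegral.integral_eq_sub_of_hasDerivAt (f := fun s => wave s w) (fun s _ => ?_)
    ((continuous_waveDeriv_left w).intervalIntegrable _ _)
  simp only [waveDeriv, wave_apply]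
  have h1 : HasDerivAt (fun s : ℝ => Complex.I * w * (s : ℂ)) (Complex.I * w) s := by
    simpa using ((hasDerivAt_id s).ofReal_comp).const_mul (Complex.I * (w : ℂ))
  have := h1.cexp
  rwa [mul_comm (Complex.exp _)] at this

theorem norm_waveDeriv_sub (s t w : ℝ) :
    ‖waveDeriv t w - waveDeriv s w‖ ^ 2 =
      w ^ 2 * ‖1 - Complex.exp (-(Complex.I * (t - s : ℝ) * w))‖ ^ 2 := by
  have h : waveDeriv t w - waveDeriv s w =
      waveDeriv t w * (1 - Complex.exp (-(Complex.I * (t - s : ℝ) * w))) := by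
    simp only [waveDeriv, wave_apply]
    rw [mul_sub, mul_one, mul_assoc (Complex.I * (w : ℂ)), ← Complex.exp_add]
    congr 3
    push_cast; ring
  rw [h, norm_mul, norm_waveDeriv, mul_pow, sq_abs]

theorem memLp_wave [IsFiniteMeasure ν] (t : ℝ) : MemLp (wave t) 2 ν :=
  MemLp.of_bound (continuous_wave t).aestronglyMeasurable 1
    (Eventually.of_forall fun w => (norm_wave t w).le)

theorem memLp_waveDeriv (h2 : Integrable (fun w : ℝ => w ^ 2) ν) (t : ℝ) :
    MemLp (waveDeriv t) 2 ν := by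
  rw [memLp_two_iff_integrable_sq_norm (continuous_waveDeriv t).aestronglyMeasurable]
  simpa only [norm_waveDeriv, sq_abs] using h2

/-- In `L²(ν)`, the Riemann sums of `i ω exp(i s ω)` over `[0, t]` converge to
`exp(i t ω) - 1`. -/
theorem tendsto_riemannSum_waveDeriv [IsFiniteMeasure ν]
    (h2 : Integrable (fun w : ℝ => w ^ 2) ν) (t : ℝ) :
    Tendsto (fun n : ℕ => ∑ k ∈ Finset.range n,
        ((t / n : ℝ) : ℂ) • (memLp_waveDeriv h2 (k * (t / n))).toLp) atTop
      (𝓝 ((memLp_wave (ν := ν) t).toLp - (memLp_wave (ν := ν) 0).toLp)) := by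
  have hsum : ∀ᵐ w ∂ν, ∀ n : ℕ, (∑ k ∈ Finset.range n,
      ((t / n : ℝ) : ℂ) • (memLp_waveDeriv h2 (k * (t / n))).toLp : Lp ℂ 2 ν) w =
      ∑ k ∈ Finset.range n, ((t / n : ℝ) : ℂ) * waveDeriv (k * (t / n)) w := by
    refine ae_all_iff.2 fun n => ?_
    have h3 : ∀ᵐ w ∂ν, ∀ k ∈ Finset.range n,
        (((t / n : ℝ) : ℂ) • (memLp_waveDeriv h2 (k * (t / n))).toLp : Lp ℂ 2 ν) w =
        ((t / n : ℝ) : ℂ) * waveDeriv (k * (t / n)) w := by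
      refine ((Finset.range n).eventually_all).2 fun k _ => ?_
      filter_upwards [Lp.coeFn_smul ((t / n : ℝ) : ℂ) (memLp_waveDeriv h2 (k * (t / n))).toLp,
        (memLp_waveDeriv h2 (k * (t / n))).coeFn_toLp] with w h4 h5
      rw [h4, Pi.smul_apply, h5, smul_eq_mul]
    filter_upwards [Lp.coeFn_fun_finsetSum (Finset.range n) fun k : ℕ =>
      (((t / n : ℝ) : ℂ) • (memLp_waveDeriv h2 (k * (t / n))).toLp : Lp ℂ 2 ν), h3] with w h4 h5
    rw [h4]
    exact Finset.sum_congr rfl h5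
  have hdiff : ∀ᵐ w ∂ν, ((memLp_wave (ν := ν) t).toLp - (memLp_wave (ν := ν) 0).toLp : Lp ℂ 2 ν) w
      = wave t w - wave 0 w := by
    filter_upwards [Lp.coeFn_sub (memLp_wave (ν := ν) t).toLp (memLp_wave (ν := ν) 0).toLp,
      (memLp_wave (ν := ν) t).coeFn_toLp, (memLp_wave (ν := ν) 0).coeFn_toLp] with w h3 h4 h5
    rw [h3, Pi.sub_apply, h4, h5]
  refine tendsto_Lp_two_of_dominated (B := fun w => |t| * |w| + 2) ?_ (fun n => ?_) ?_
  · have h3 : Integrable (fun w : ℝ => 2 * t ^ 2 * w ^ 2 + 8) ν :=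
      (h2.const_mul (2 * t ^ 2)).add (integrable_const 8)
    refine h3.mono' (Continuous.aestronglyMeasurable (by fun_prop))
      (Eventually.of_forall fun w => ?_)
    rw [Real.norm_of_nonneg (by positivity), ← sq_abs t, ← sq_abs w]
    nlinarith [sq_nonneg (|t| * |w| - 2)]
  · filter_upwards [hsum, hdiff] with w h3 h4
    rw [h3, h4]
    refine (norm_sub_le _ _).trans (add_le_add ?_ ?_)
    · have h5 : ∀ k ∈ Finset.range n, ‖((t / n : ℝ) : ℂ) * waveDeriv (k * (t / n)) w‖ ≤
          |t| / n * |w| := by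
        intro k _
        rw [norm_mul, norm_waveDeriv, Complex.norm_real, Real.norm_eq_abs, abs_div, Nat.abs_cast]
      refine (norm_sum_le_of_le _ h5).trans ?_
      rw [Finset.sum_const, Finset.card_range, nsmul_eq_mul, ← mul_assoc]
      refine mul_le_mul_of_nonneg_right ?_ (abs_nonneg w)
      rcases Nat.eq_zero_or_pos n with h | h
      · simp [h]
      · have : (n : ℝ) ≠ 0 := by positivity
        rw [mul_div_cancel₀ _ this]
    · refine (norm_sub_le _ _).trans ?_
      rw [norm_wave, norm_wave]; norm_num
  · filter_upwards [hsum, hdiff] with w h3 h4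
    rw [h4, ← integral_waveDeriv]
    simp only [h3]
    exact tendsto_riemannSum (continuous_waveDeriv_left w) t

/-! ### Elementary properties of the kernel -/

/-- Positive definiteness for the times `t, 0` and the coefficients `1, -1`. -/
theorem IsPositiveDefinite.le_zero_apply {K : ℝ → ℝ} (hs : ∀ t, K (-t) = K t)
    (h : IsPositiveDefinite fun t => (K t : ℂ)) (t : ℝ) : K t ≤ K 0 := by
  have h1 := h.2 2 ![t, 0] ![1, -1]
  simp only [Fin.sum_univ_two, Matrix.cons_val_zero, Matrix.cons_val_one, sub_self, sub_zero,
    zero_sub, hs, map_neg, map_one, mul_one, mul_neg, neg_neg] at h1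
  have h2 : (0 : ℂ) ≤ ((2 * K 0 - 2 * K t : ℝ) : ℂ) := by
    refine h1.trans (le_of_eq ?_)
    push_cast; ring
  have h3 : 0 ≤ 2 * K 0 - 2 * K t := by exact_mod_cast h2
  linarith

/-- At distance at most `2⁻ⁿ` the logarithmic modulus of `K` at the origin is of order `n⁻ᵇ`, and
the quadratic term is negligible. -/
theorem eventually_modulus_le {K : ℝ → ℝ} {b : ℝ} (hs : ∀ t, K (-t) = K t) (hb : 0 < b)
    (hlog : (fun t : ℝ => K 0 - K t) =O[𝓝[>] 0] fun t : ℝ => |Real.log t| ^ (-b)) :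
    ∃ C : ℝ, 0 < C ∧ ∀ᶠ n : ℕ in atTop, ∀ h : ℝ, |h| ≤ (1 / 2) ^ n →
      (K 0 - K h) + h ^ 2 ≤ C * (n : ℝ) ^ (-b) := by
  obtain ⟨c, hc, hO⟩ := hlog.exists_pos
  have hO' := hO.bound
  rw [eventually_nhdsWithin_iff, Metric.eventually_nhds_iff] at hO'
  obtain ⟨δ, hδ, hδb⟩ := hO'
  have hlog2 : 0 < Real.log 2 := Real.log_pos one_lt_two
  have hhalf : Tendsto (fun n : ℕ => (1 / 2 : ℝ) ^ n) atTop (𝓝 0) :=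
    tendsto_pow_atTop_nhds_zero_of_lt_one (by norm_num) (by norm_num)
  have hgeom := tendsto_pow_const_mul_const_pow_of_abs_lt_one ⌈b⌉₊ (r := (1 / 4 : ℝ))
    (by rw [abs_of_pos] <;> norm_num)
  refine ⟨c * Real.log 2 ^ (-b) + 1, by positivity, ?_⟩
  filter_upwards [hhalf.eventually (gt_mem_nhds hδ), hgeom.eventually (gt_mem_nhds one_pos),
    eventually_gt_atTop 0] with n hn1 hn2 hn0 h hh
  have hn : (0 : ℝ) < n := by exact_mod_cast hn0
  have hn1' : (1 : ℝ) ≤ n := by exact_mod_cast hn0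
  have hsq : h ^ 2 ≤ (n : ℝ) ^ (-b) := by
    have h1 : h ^ 2 ≤ (1 / 4) ^ n := by
      rw [← sq_abs]
      calc |h| ^ 2 ≤ ((1 / 2) ^ n) ^ 2 := by gcongr
        _ = (1 / 4) ^ n := by rw [← pow_mul, mul_comm, pow_mul]; norm_num
    have h2 : (n : ℝ) ^ b ≤ (n : ℝ) ^ ⌈b⌉₊ := by
      rw [← Real.rpow_natCast]
      exact Real.rpow_le_rpow_of_exponent_le hn1' (Nat.le_ceil b)
    have h3 : (n : ℝ) ^ b * (1 / 4) ^ n ≤ 1 :=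
      (mul_le_mul_of_nonneg_right h2 (by positivity)).trans hn2.le
    rw [Real.rpow_neg hn.le, ← one_div, le_div_iff₀ (by positivity), mul_comm]
    exact (mul_le_mul_of_nonneg_left h1 (by positivity)).trans h3
  have hpos : ∀ r : ℝ, 0 < r → r ≤ (1 / 2) ^ n →
      K 0 - K r ≤ c * Real.log 2 ^ (-b) * (n : ℝ) ^ (-b) := by
    intro r hr hrn
    have h1 := hδb (y := r) (by rw [Real.dist_eq, sub_zero, abs_of_pos hr]; linarith) hr
    have h2 : (n : ℝ) * Real.log 2 ≤ |Real.log r| := by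
      have h3 := Real.log_le_log hr hrn
      rw [Real.log_pow, one_div, Real.log_inv] at h3
      have := neg_le_abs (Real.log r)
      linarith
    have h4 : |Real.log r| ^ (-b) ≤ Real.log 2 ^ (-b) * (n : ℝ) ^ (-b) := by
      rw [mul_comm, ← Real.mul_rpow hn.le hlog2.le]
      exact Real.rpow_le_rpow_of_nonpos (by positivity) h2 (by linarith)
    rw [Real.norm_of_nonneg (by positivity : 0 ≤ |Real.log r| ^ (-b))] at h1
    calc K 0 - K r ≤ ‖K 0 - K r‖ := Real.le_norm_self _
      _ ≤ c * |Real.log r| ^ (-b) := h1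
      _ ≤ _ := by rw [mul_assoc]; gcongr
  have hK : K 0 - K h ≤ c * Real.log 2 ^ (-b) * (n : ℝ) ^ (-b) := by
    rcases lt_trichotomy h 0 with h0 | h0 | h0
    · rw [← hs h]
      exact hpos (-h) (by linarith) (by rwa [abs_of_neg h0] at hh)
    · rw [h0, sub_self]; positivity
    · exact hpos h h0 (by rwa [abs_of_pos h0] at hh)
  rw [add_mul, one_mul]
  exact add_le_add hK hsq

/-! ### The velocity process -/

theorem isFun_fourierT_delta (t : ℝ) : IsFun (fourierT (TemperedDistribution.delta t))
    fun w : ℝ => Complex.exp (-(Complex.I * t * w)) := by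
  intro χ
  refine ⟨χ.integrable.bdd_mul (c := 1) (Continuous.aestronglyMeasurable (by fun_prop))
    (Eventually.of_forall fun w => (norm_exp_neg_I_mul t w).le), ?_⟩
  rw [fourierT_apply, TemperedDistribution.delta_apply, fourierS_apply]
  refine integral_congr_ae (Eventually.of_forall fun w => ?_)
  simp only
  rw [mul_comm, mul_right_comm]

theorem memLp_exp [IsFiniteMeasure ν] (t : ℝ) :
    MemLp (fun w : ℝ => Complex.exp (-(Complex.I * t * w))) 2 ν :=
  MemLp.of_bound (Continuous.aestronglyMeasurable (by fun_prop)) 1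
    (Eventually.of_forall fun w => (norm_exp_neg_I_mul t w).le)

theorem RandomMeasure.process_eq [IsFiniteMeasure ν] (hac : ν ≪ volume) (ξ : RandomMeasure ν P)
    (t : ℝ) : ξ.process t = ξ.integral (memLp_wave (ν := ν) t).toLp :=
  ξ.op_eq hac (isFun_fourierT_delta t) (memLp_exp t)

/-- If the stochastic integrals of the derivatives of the waves have a continuous version, then
integrating that version in time gives a continuously differentiable version of the process. -/
theorem RandomMeasure.exists_contDiff_version [IsFiniteMeasure ν] (hac : ν ≪ volume)
    (ξ : RandomMeasure ν P) (h2 : Integrable (fun w : ℝ => w ^ 2) ν) {Z : ℝ → Ω → ℂ}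
    (hZc : ∀ᵐ x ∂P, Continuous fun t => Z t x)
    (hZ : ∀ t, Z t =ᵐ[P] ξ.integral (memLp_waveDeriv h2 t).toLp) :
    ∃ η : ℝ → Ω → ℂ, (∀ t : ℝ, η t =ᵐ[P] ξ.process t) ∧
      ∀ᵐ x ∂P, ContDiff ℝ 1 fun t : ℝ => η t x := by
  refine ⟨fun t x => ξ.process 0 x + ∫ s in (0 : ℝ)..t, Z s x, fun t => ?_, ?_⟩
  -- the same Riemann sums converge in `L²` to the increment of the process and pathwise to `∫ Z`
  · have hlim := (ξ.integral.continuous.tendsto _).comp (tendsto_riemannSum_waveDeriv h2 t)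
    rw [map_sub, ← ξ.process_eq hac, ← ξ.process_eq hac] at hlim
    obtain ⟨ns, hns, hae⟩ := (tendstoInMeasure_of_tendsto_Lp hlim).exists_seq_tendsto_ae
    have hsum : ∀ᵐ x ∂P, ∀ n : ℕ, ξ.integral (∑ k ∈ Finset.range n,
        ((t / n : ℝ) : ℂ) • (memLp_waveDeriv h2 (k * (t / n))).toLp) x =
        ∑ k ∈ Finset.range n, ((t / n : ℝ) : ℂ) * Z (k * (t / n)) x := by
      refine ae_all_iff.2 fun n => ?_
      have h3 : ∀ᵐ x ∂P, ∀ k ∈ Finset.range n,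
          (((t / n : ℝ) : ℂ) • ξ.integral (memLp_waveDeriv h2 (k * (t / n))).toLp : Lp ℂ 2 P) x =
          ((t / n : ℝ) : ℂ) * Z (k * (t / n)) x := by
        refine ((Finset.range n).eventually_all).2 fun k _ => ?_
        filter_upwards [Lp.coeFn_smul ((t / n : ℝ) : ℂ)
          (ξ.integral (memLp_waveDeriv h2 (k * (t / n))).toLp), hZ (k * (t / n))] with x h4 h5
        rw [h4, Pi.smul_apply, h5, smul_eq_mul]
      rw [map_sum]
      simp only [map_smul]
      filter_upwards [Lp.coeFn_fun_finsetSum (Finset.range n) fun k : ℕ =>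
        (((t / n : ℝ) : ℂ) • ξ.integral (memLp_waveDeriv h2 (k * (t / n))).toLp : Lp ℂ 2 P), h3]
        with x h4 h5
      rw [h4]
      exact Finset.sum_congr rfl h5
    filter_upwards [hsum, hae, hZc, Lp.coeFn_sub (ξ.process t) (ξ.process 0)] with x h3 h4 h5 h6
    have h7 := (tendsto_riemannSum h5 t).comp hns.tendsto_atTop
    simp only [Function.comp_apply, h3] at h4
    have h8 := tendsto_nhds_unique h7 h4
    rw [h8, h6, Pi.sub_apply]
    ring
  · filter_upwards [hZc] with x hx
    have hd : ∀ t, HasDerivAt (fun t => ξ.process 0 x + ∫ s in (0 : ℝ)..t, Z s x) (Z t x) t :=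
      fun t => (intervalIntegral.integral_hasDerivAt_right (hx.intervalIntegrable _ _)
        (hx.stronglyMeasurableAtFilter _ _) hx.continuousAt).const_add _
    rw [contDiff_one_iff_deriv]
    refine ⟨fun t => (hd t).differentiableAt, ?_⟩
    rw [show deriv (fun t => ξ.process 0 x + ∫ s in (0 : ℝ)..t, Z s x) = fun t => Z t x from
      funext fun t => (hd t).deriv]
    exact hx

end GLE
end

theorem mainTheorem10
    -- the parameters and the memory kernel
    (m β b : ℝ) (hm : 0 < m) (hβ : 0 < β) (hb : 3 < b)
    (K : ℝ → ℝ) (hK : GLE.IsAdmissible K)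
    (hpd : GLE.IsPositiveDefinite fun t => (K t : ℂ))
    (hlog : (fun t : ℝ => K 0 - K t) =O[𝓝[>] 0] fun t : ℝ => |Real.log t| ^ (-b))
    -- the noises
    {Ω' : Type*} [MeasurableSpace Ω'] (P' : Measure Ω') [IsProbabilityMeasure P']
    (W F : 𝓢(ℝ, ℝ) →ₗ[ℝ] Lp ℂ 2 P')
    (hW : GLE.IsWhiteNoise W) (hF : GLE.HasCovariance K F)
    -- the spectral measure and the Gaussian random measure that give the operator `V`
    {Ω : Type*} [MeasurableSpace Ω] (P : Measure Ω) [IsProbabilityMeasure P]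
    (ν : Measure ℝ) (hν : GLE.IsSpectralMeasure ν) (hac : ν ≪ volume)
    (ξ : GLE.RandomMeasure ν P) (hξ : ξ.IsGaussian)
    -- `V` is a weak solution, with `λ = 0`
    (hV : GLE.IsWeakSolution m 0 β K W F ξ) :
    -- `V(t) = ⟨V, δ_t⟩` is well defined and has a version with continuously differentiable paths
    (∀ t : ℝ, TemperedDistribution.delta t ∈ GLE.Dom ν) ∧
    ∃ η : ℝ → Ω → ℂ, (∀ t : ℝ, η t =ᵐ[P] ξ.process t) ∧
      ∀ᵐ x ∂P, ContDiff ℝ 1 fun t : ℝ => η t x := by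
  have hs := hK.symm
  have hc : Continuous K := by
    simpa [Function.comp_def] using Complex.continuous_re.comp hpd.1
  have hle := hpd.le_zero_apply hs
  have h0 : ∀ t, 0 ≤ K t := by
    intro t
    rcases eq_or_ne t 0 with h | h
    · rw [h]; exact (hK.pos 1 one_ne_zero).le.trans (hle 1)
    · exact (hK.pos t h).le
  have hM : ∀ t, ‖K t‖ ≤ K 0 := fun t => by rw [Real.norm_of_nonneg (h0 t)]; exact hle t
  obtain ⟨A, hA⟩ := hK.eventually_decreasing
  obtain ⟨R, hR, hE⟩ := hV.exists_energy_le hm hβ hν hac hc h0 hle hA hK.tendsto_zero hF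
  obtain ⟨hfin, h2, C, hC, hbound⟩ := GLE.exists_spectral_bounds hm hβ hR hν hc hM hs hle hE
  refine ⟨fun t => ⟨_, GLE.isFun_fourierT_delta t, GLE.memLp_exp t⟩, ?_⟩
  obtain ⟨C', hC', hmod⟩ := GLE.eventually_modulus_le hs (by linarith) hlog
  obtain ⟨Z, hZc, hZ⟩ := hξ.exists_continuous_version
    (fun t => (GLE.memLp_waveDeriv h2 t).toLp) (C := (C + 1) * C') (b := b) (by positivity) hb (by
      filter_upwards [hmod] with n hn s t hst
      have h1 : ‖(GLE.memLp_waveDeriv h2 t).toLp - (GLE.memLp_waveDeriv h2 s).toLp‖ ^ 2 =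
          ∫ w, w ^ 2 * ‖1 - Complex.exp (-(Complex.I * (t - s : ℝ) * w))‖ ^ 2 ∂ν := by
        rw [GLE.norm_sq_eq_integral]
        refine integral_congr_ae ?_
        filter_upwards [Lp.coeFn_sub (GLE.memLp_waveDeriv h2 t).toLp
          (GLE.memLp_waveDeriv h2 s).toLp, (GLE.memLp_waveDeriv h2 t).coeFn_toLp,
          (GLE.memLp_waveDeriv h2 s).coeFn_toLp] with w e1 e2 e3
        rw [e1, Pi.sub_apply, e2, e3, GLE.norm_waveDeriv_sub]
      rw [h1]
      refine (hbound (t - s)).trans ?_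
      have h3 := hn (t - s) hst
      have h4 : 0 ≤ K 0 - K (t - s) := sub_nonneg.2 (hle _)
      rw [mul_assoc]
      exact mul_le_mul (by linarith) h3 (by positivity) (by positivity))
  exact ξ.exists_contDiff_version hac h2 hZc hZ
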